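/- Let $X$ and $B$ be complex manifolds, $Y=X\times B$ with projections $p_X,p_B$, and let $T^*_{X,-}$, $T^*_{B,-}$, $T^*_{Y,-}$ be locally free $\mathcal O$-modules of finite rank on $X$, $B$, $Y$ together with a short exact sequence of $\mathcal O_Y$-modules $$0\longrightarrow p_B^*T^*_{B,-}\longrightarrow T^*_{Y,-}\longrightarrow p_X^*T^*_{X,-}\longrightarrow 0$$ (a $gt$-model). Write $T^*_{Y,(\pm)^j}$ for the holomorphic cotangent sheaf $T^*_Y$ if $j$ is even and for $T^*_{Y,-}$ if $j$ is odd. Let $F^j_k\subseteq\wedge^jT^*_{Y,-}$ be the subsheaf spanned by the products with at least $k$ factors in $p_B^*T^*_{B,-}$, so that $F^j_b/F^j_{b+1}\cong\wedge^bT^*_{B,-}\boxtimes\wedge^aT^*_{X,-}$ for $a+b=j$, and put $$\mathbf H^{a,b}_p=H^p\big(Y,\mathcal Hom_{\mathcal O_Y}(T^*_{Y,(\pm)^{a+b}},\wedge^bT^*_{B,-}\boxtimes\wedge^aT^*_{X,-})\big).$$ For $a\ge 1$ and $j=a+b$ let $\partial^{a,b}_p:\mathbf H^{a,b}_p\to\mathbf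 H^{a-1,b+1}_{p+1}$ be the connecting map of $0\to F^j_{b+1}\to F^j_b\to F^j_b/F^j_{b+1}\to0$, after applying $\mathcal Hom(T^*_{Y,(\pm)^j},-)$, followed by the map induced by $F^j_{b+1}\to F^j_{b+1}/F^j_{b+2}$. Let $\Theta(T^*_{Y,-})\in \mathrm{Ext}^1(p_X^*T^*_{X,-},p_B^*T^*_{B,-})=H^1(Y,\mathcal Hom(p_X^*T^*_{X,-},p_B^*T^*_{B,-}))$ be the class of the extension, and let $$(\Theta(T^*_{Y,-}),-)^{a,b}_*:\mathbf H^{a,b}_p\to\mathbf H^{a-1,b+1}_{p+1}$$ be the model class map: the cup product with $\Theta(T^*_{Y,-})$, given on Čech cochains by $(\theta\cdot c)_{i_0\cdots i_{p+1}}=\langle\theta_{i_0i_1},c_{i_1\cdots i_{p+1}}\rangle$, where the pairing $\langle\theta,\cdot\rangle$ is the composite $$\wedge^bT^*_{B,-}\otimes\wedge^aT^*_{X,-}\to\wedge^bT^*_{B,-}\otimes T^*_{X,-}\otimes\wedge^{a-1}T^*_{X,-}\xrightarrow{\ \theta\ }\wedge^bT^*_{B,-}\otimes T^*_{B,-}\otimes\wedge^{a-1}T^*_{X,-}\xrightarrow{\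 \wedge\ }\wedge^{b+1}T^*_{B,-}\otimes\wedge^{a-1}T^*_{X,-}$$ whose first map is induced by $x_1\wedge\dots\wedge x_a\mapsto\frac1{a!}\sum_k(-1)^{k-1}x_k\otimes(x_1\wedge\cdots\widehat{x_k}\cdots\wedge x_a)$. Then for every $gt$-model, every $j'\ge1$ and every $p\ge0$, $$\mathrm{im}\,(\Theta(T^*_{Y,-}),-)^{1,j'-1}_*\ \subseteq\ \mathrm{im}\,\partial^{1,j'-1}_p\qquad\text{in }\mathbf H^{0,j'}_{p+1}.$$ -/

import Mathlib

open scoped Manifold ContDiff Bundle TensorProduct Topology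
open Filter

universe u v w

noncomputable section

/-! ### Combinatorial cochains -/

section Cochains

variable {ι A : Type*} [AddCommGroup A]

/-- The Cech differential `(δc)(i₀,…,iₙ) = ∑ₖ (-1)ᵏ c(i₀,…,îₖ,…,iₙ)`. -/
def cechD {n : ℕ} (c : (Fin n → ι) → A) (σ : Fin (n + 1) → ι) : A :=
  ∑ k : Fin (n + 1), (-1 : ℤ) ^ (k : ℕ) • c (σ ∘ k.succAbove)

theorem cechD_cons {n : ℕ} (c : (Fin (n + 1) → ι) → A) (y : ι) (τ : Fin (n + 1) → ι) :
    cechD c (Fin.cons y τ : Fin (n + 2) → ι) =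
      c τ - cechD (fun τ' => c (Fin.cons y τ' : Fin (n + 1) → ι)) τ := by
  unfold cechD
  rw [Fin.sum_univ_succ, sub_eq_add_neg, ← Finset.sum_neg_distrib]
  congr 1
  · simp [Function.comp_def]
  · refine Finset.sum_congr rfl fun k _ => ?_
    rw [Fin.val_succ, pow_succ]
    have : (Fin.cons y τ : Fin (n + 2) → ι) ∘ k.succ.succAbove
        = (Fin.cons y (τ ∘ k.succAbove) : Fin (n + 1) → ι) := by
      funext m
      refine Fin.cases ?_ (fun m => ?_) m <;> simp
    rw [this]; simp

theorem cechD_zero_len (c : (Fin 0 → ι) → A) (τ : Fin 1 → ι) :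
    cechD c τ = c Fin.elim0 := by
  simp [cechD]
  exact congrArg c (Subsingleton.elim _ _)

theorem cechD_sub {n : ℕ} (c e : (Fin n → ι) → A) (τ : Fin (n + 1) → ι) :
    cechD (fun τ' => c τ' - e τ') τ = cechD c τ - cechD e τ := by
  simp [cechD, smul_sub]

theorem cechD_add {n : ℕ} (c e : (Fin n → ι) → A) (τ : Fin (n + 1) → ι) :
    cechD (fun τ' => c τ' + e τ') τ = cechD c τ + cechD e τ := by
  simp [cechD, smul_add, Finset.sum_add_distrib]

theorem cechD_smul {R : Type*} [Ring R] [Module R A] {n : ℕ} (r : R) (c : (Fin n → ι) → A)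
    (τ : Fin (n + 1) → ι) :
    cechD (fun τ' => r • c τ') τ = r • cechD c τ := by
  simp only [cechD, Finset.smul_sum]
  exact Finset.sum_congr rfl fun k _ => smul_comm _ _ _

theorem cechD_map {A' : Type*} [AddCommGroup A'] (f : A →+ A') {n : ℕ} (c : (Fin n → ι) → A)
    (τ : Fin (n + 1) → ι) : f (cechD c τ) = cechD (fun τ' => f (c τ')) τ := by
  simp [cechD, map_sum]

theorem cechD_cechD {n : ℕ} (c : (Fin n → ι) → A) (σ : Fin (n + 2) → ι) :
    cechD (cechD c) σ = 0 := by
  induction n with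
  | zero =>
    rw [← Fin.cons_self_tail σ, cechD_cons, cechD_zero_len, cechD_zero_len, cechD_zero_len, sub_self]
  | succ n ih =>
    rw [← Fin.cons_self_tail σ, cechD_cons]
    simp only [cechD_cons, cechD_sub]
    rw [ih]; simp

/-- The cup product of a `1`-cochain with an `n`-tuple cochain along a bi-additive pairing. -/
def cup1 {P A' : Type*} [AddCommGroup P] [AddCommGroup A'] (m : P → A → A') {n : ℕ}
    (θ : (Fin 2 → ι) → P) (c : (Fin (n + 1) → ι) → A) (σ : Fin (n + 2) → ι) : A' :=
  m (θ ![σ 0, σ 1]) (c (Fin.tail σ))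

/-- The prism operator of a change of indices `f`. -/
def prism (f : ι → ι) : {n : ℕ} → ((Fin (n + 1) → ι) → A) → (Fin n → ι) → A
  | 0, _, _ => 0
  | (n + 1), c, σ => c (Fin.cons (σ 0) (f ∘ σ) : Fin (n + 2) → ι) -
      prism f (n := n) (fun τ => c (Fin.cons (σ 0) τ : Fin (n + 2) → ι)) (Fin.tail σ)

theorem prism_sub (f : ι → ι) {n : ℕ} (c e : (Fin (n + 1) → ι) → A) (σ : Fin n → ι) :
    prism f (fun τ => c τ - e τ) σ = prism f c σ - prism f e σ := by
  induction n with
  | zero => simp [prism]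
  | succ n ih => simp only [prism, ih]; abel

theorem comp_cons (f : ι → ι) {n : ℕ} (y : ι) (τ : Fin n → ι) :
    f ∘ (Fin.cons y τ : Fin (n + 1) → ι) = (Fin.cons (f y) (f ∘ τ) : Fin (n + 1) → ι) := by
  funext m
  refine Fin.cases ?_ (fun m => ?_) m <;> simp

theorem prism_cons (f : ι → ι) {n : ℕ} (c : (Fin (n + 2) → ι) → A) (y : ι) (τ : Fin n → ι) :
    prism f c (Fin.cons y τ : Fin (n + 1) → ι) =
      c (Fin.cons y (Fin.cons (f y) (f ∘ τ) : Fin (n + 1) → ι) : Fin (n + 2) → ι) -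
        prism f (fun τ' => c (Fin.cons y τ' : Fin (n + 2) → ι)) τ := by
  simp [prism, comp_cons]

theorem cechD_comp (f : ι → ι) {n : ℕ} (c : (Fin n → ι) → A) (τ : Fin (n + 1) → ι) :
    cechD (fun τ' => c (f ∘ τ')) τ = cechD c (f ∘ τ) := rfl

theorem prism_homotopy (f : ι → ι) {n : ℕ} (c : (Fin (n + 1) → ι) → A) (σ : Fin (n + 1) → ι) :
    cechD (prism f c) σ + prism f (cechD c) σ = c (f ∘ σ) - c σ := by
  induction n with
  | zero =>
    obtain ⟨y, τ, rfl⟩ : ∃ y τ, σ = (Fin.cons y τ : Fin 1 → ι) :=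
      ⟨_, _, (Fin.cons_self_tail σ).symm⟩
    obtain rfl : τ = Fin.elim0 := Subsingleton.elim _ _
    rw [cechD_zero_len, prism_cons, cechD_cons, cechD_zero_len, comp_cons]
    simp only [prism]; abel
  | succ n ih =>
    obtain ⟨y, τ, rfl⟩ : ∃ y τ, σ = (Fin.cons y τ : Fin (n + 2) → ι) :=
      ⟨_, _, (Fin.cons_self_tail σ).symm⟩
    have ih' := ih (fun τ' => c (Fin.cons y τ' : Fin (n + 2) → ι)) τ
    simp only [prism_cons, cechD_cons, comp_cons, cechD_sub, prism_sub]
    rw [cechD_comp f (fun τ' => c (Fin.cons y (Fin.cons (f y) τ' : Fin (n + 1) → ι) :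
      Fin (n + 2) → ι)) τ]
    rw [← eq_sub_iff_add_eq] at ih'
    rw [ih']; abel

theorem prism_mem (f : ι → ι) (K : AddSubgroup A) {n : ℕ} (c : (Fin (n + 1) → ι) → A)
    (σ : Fin n → ι)
    (h : ∀ τ : Fin (n + 1) → ι, (∀ m, ∃ k, τ m = σ k ∨ τ m = f (σ k)) → c τ ∈ K) :
    prism f c σ ∈ K := by
  induction n with
  | zero => exact K.zero_mem
  | succ n ih =>
    refine K.sub_mem (h _ fun m => ?_) (ih _ _ fun τ hτ => h _ fun m => ?_)
    · refine Fin.cases ⟨0, Or.inl rfl⟩ (fun m => ⟨m, Or.inr rfl⟩) m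
    · refine Fin.cases ⟨0, Or.inl rfl⟩ (fun m => ?_) m
      obtain ⟨k, hk⟩ := hτ m
      exact ⟨k.succ, hk⟩

theorem cechD_mem (K : AddSubgroup A) {n : ℕ} (c : (Fin n → ι) → A)
    (σ : Fin (n + 1) → ι) (h : ∀ k : Fin (n + 1), c (σ ∘ k.succAbove) ∈ K) :
    cechD c σ ∈ K :=
  K.sum_mem fun k _ => K.zsmul_mem (h k) _

theorem cechD_two {P : Type*} [AddCommGroup P] (θ : (Fin 2 → ι) → P) (σ : Fin 3 → ι) :
    cechD θ σ = θ ![σ 1, σ 2] - θ ![σ 0, σ 2] + θ ![σ 0, σ 1] := by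
  refine (Fin.sum_univ_three (f := fun k : Fin 3 => (-1 : ℤ) ^ (k : ℕ) • θ (σ ∘ k.succAbove))).trans ?_
  have h0 : σ ∘ (0 : Fin 3).succAbove = ![σ 1, σ 2] := by
    funext m; fin_cases m <;> rfl
  have h1 : σ ∘ (1 : Fin 3).succAbove = ![σ 0, σ 2] := by
    funext m; fin_cases m <;> rfl
  have h2 : σ ∘ (2 : Fin 3).succAbove = ![σ 0, σ 1] := by
    funext m; fin_cases m <;> rfl
  simp only [h0, h1, h2]; simp; abel

theorem cechD_one {P : Type*} [AddCommGroup P] (ε : (Fin 1 → ι) → P) (x y : ι) :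
    cechD ε ![x, y] = ε ![y] - ε ![x] := by
  refine (Fin.sum_univ_two
    (f := fun k : Fin 2 => (-1 : ℤ) ^ (k : ℕ) • ε (![x, y] ∘ k.succAbove))).trans ?_
  have h0 : ![x, y] ∘ (0 : Fin 2).succAbove = ![y] := by
    funext m; fin_cases m; rfl
  have h1 : ![x, y] ∘ (1 : Fin 2).succAbove = ![x] := by
    funext m; fin_cases m; rfl
  simp only [h0, h1]; simp; abel

variable {P A' : Type*} [AddCommGroup P] [AddCommGroup A']

/-- Leibniz rule for the cup product with a `1`-cochain. -/
theorem cechD_cup1 (m : P →+ A →+ A') {n : ℕ} (θ : (Fin 2 → ι) → P)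
    (c : (Fin (n + 1) → ι) → A) (σ : Fin (n + 3) → ι) :
    cechD (cup1 (fun a b => m a b) θ c) σ =
      m (cechD θ ![σ 0, σ 1, σ 2]) (c (Fin.tail (Fin.tail σ))) -
        m (θ ![σ 0, σ 1]) (cechD c (Fin.tail σ)) := by
  obtain ⟨x, τ, rfl⟩ : ∃ x τ, σ = (Fin.cons x τ : Fin (n + 3) → ι) :=
    ⟨_, _, (Fin.cons_self_tail σ).symm⟩
  obtain ⟨y, ρ, rfl⟩ : ∃ y ρ, τ = (Fin.cons y ρ : Fin (n + 2) → ι) :=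
    ⟨_, _, (Fin.cons_self_tail τ).symm⟩
  rw [cechD_cons]
  have e1 : (fun τ' : Fin (n + 1) → ι => cup1 (fun a b => m a b) θ c
      (Fin.cons x τ' : Fin (n + 2) → ι)) = fun τ' => m (θ ![x, τ' 0]) (c τ') := by
    funext τ'; simp [cup1]
  rw [e1, cechD_cons, cechD_two]
  have e2 : cechD (fun τ' : Fin n → ι => m (θ ![x, (Fin.cons y τ' : Fin (n + 1) → ι) 0])
      (c (Fin.cons y τ' : Fin (n + 1) → ι))) ρ
      = m (θ ![x, y]) (cechD (fun τ' : Fin n → ι => c (Fin.cons y τ' : Fin (n + 1) → ι)) ρ) := by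
    rw [cechD_map]; rfl
  rw [e2]
  simp only [Fin.tail_cons, Fin.cons_zero, cechD_cons]
  have h1 : (Fin.cons x (Fin.cons y ρ : Fin (n + 2) → ι) : Fin (n + 3) → ι) 1 = y := rfl
  have h2 : (Fin.cons x (Fin.cons y ρ : Fin (n + 2) → ι) : Fin (n + 3) → ι) 2 = ρ 0 := rfl
  simp only [cup1, h1, h2]
  simp [Fin.tail_cons]
  abel

theorem cechD_cup0 (m : P →+ A →+ A') {n : ℕ} (ε : (Fin 1 → ι) → P)
    (c : (Fin (n + 1) → ι) → A) (σ : Fin (n + 2) → ι) :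
    cechD (fun τ : Fin (n + 1) → ι => m (ε ![τ 0]) (c τ)) σ =
      cup1 (fun a b => m a b) (cechD ε) c σ + m (ε ![σ 0]) (cechD c σ) := by
  obtain ⟨x, τ, rfl⟩ : ∃ x τ, σ = (Fin.cons x τ : Fin (n + 2) → ι) :=
    ⟨_, _, (Fin.cons_self_tail σ).symm⟩
  rw [cechD_cons, cechD_cons, map_sub, cechD_map]
  have h1 : (Fin.cons x τ : Fin (n + 2) → ι) 1 = τ 0 := rfl
  simp only [cup1, Fin.cons_zero, h1, Fin.tail_cons, cechD_one]
  simp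

end Cochains

/-! ### Sheaves of modules over the holomorphic functions and their Cech cohomology -/

section Sheaves

variable {E : Type*} [NormedAddCommGroup E] [NormedSpace ℂ E] {H : Type*} [TopologicalSpace H]

/-- `f` is a holomorphic function near `y`. -/
def HolFun (I : ModelWithCorners ℂ E H) {Y : Type*} [TopologicalSpace Y] [ChartedSpace H Y]
    (y : Y) (f : Y → ℂ) : Prop :=
  ∀ᶠ z in 𝓝 y, ContMDiffAt I 𝓘(ℂ, ℂ) ω f z

/-- A sheaf of `𝒪_Y`-modules (such as the sheaf of holomorphic sections of a vector bundle),
presented as a sheaf of sections of a family of complex vector spaces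
`fib z`, `z ∈ Y`. `HolAt y` consists of the families `s` whose germ at `y` belongs to the sheaf; the
sections over an open set `U` are the families on `U` with `s ∈ HolAt y` for every `y ∈ U`, so that
the sheaf axioms hold automatically. Values of `s` away from `y` are irrelevant by `congr`. -/
structure FibSheaf (I : ModelWithCorners ℂ E H) (Y : Type u) [TopologicalSpace Y]
    [ChartedSpace H Y] where
  fib : Y → Type v
  [grp : ∀ z, AddCommGroup (fib z)]
  [mod : ∀ z, Module ℂ (fib z)]
  HolAt : Y → Submodule ℂ (∀ z, fib z)
  congr : ∀ {y : Y} {s t : ∀ z, fib z}, (∀ᶠ z in 𝓝 y, s z = t z) → s ∈ HolAt y → t ∈ HolAt y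
  spread : ∀ {y : Y} {s : ∀ z, fib z}, s ∈ HolAt y → ∀ᶠ z in 𝓝 y, s ∈ HolAt z
  smul_hol : ∀ {y : Y} {f : Y → ℂ} {s : ∀ z, fib z}, HolFun I y f → s ∈ HolAt y →
    (fun z => f z • s z) ∈ HolAt y

attribute [instance] FibSheaf.grp FibSheaf.mod

variable {I : ModelWithCorners ℂ E H} {Y : Type u} [TopologicalSpace Y] [ChartedSpace H Y]

/-- An `𝒪_Y`-linear morphism, given by linear maps of the fibres. -/
structure FibHom (S : FibSheaf.{u, v} I Y) (T : FibSheaf.{u, w} I Y) where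
  app : ∀ z, S.fib z →ₗ[ℂ] T.fib z
  hol : ∀ (y : Y) (s : ∀ z, S.fib z), s ∈ S.HolAt y → (fun z => app z (s z)) ∈ T.HolAt y

/-- The sheaf `ℋom_𝒪(S, T)`: families of linear maps of the fibres that carry sections of `S` to
sections of `T`. -/
def FibSheaf.hom (S : FibSheaf.{u, v} I Y) (T : FibSheaf.{u, w} I Y) :
    FibSheaf.{u, max v w} I Y where
  fib z := S.fib z →ₗ[ℂ] T.fib z
  HolAt y :=
    { carrier := {φ | ∀ᶠ x in 𝓝 y, ∀ s ∈ S.HolAt x, (fun z => φ z (s z)) ∈ T.HolAt x}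
      zero_mem' := Eventually.of_forall fun x _ _ => (T.HolAt x).zero_mem
      add_mem' := fun {a b} ha hb => by
        filter_upwards [ha, hb] with x hx hx' s hs
        exact (T.HolAt x).add_mem (hx s hs) (hx' s hs)
      smul_mem' := fun r a ha => by
        filter_upwards [ha] with x hx s hs
        exact (T.HolAt x).smul_mem r (hx s hs) }
  congr := fun {y a b} hab ha => by
    filter_upwards [ha, hab.eventually_nhds] with x hx hx' s hs
    exact T.congr (hx'.mono fun z hz => by rw [hz]) (hx s hs)
  spread := fun {y a} ha => ha.eventually_nhds
  smul_hol := fun {y f a} hf ha => by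
    filter_upwards [ha, hf.eventually_nhds] with x hx hx' s hs
    exact T.smul_hol hx' (hx s hs)

/-- Postcomposition `ℋom(R, S) → ℋom(R, T)`. -/
def FibHom.post (R : FibSheaf.{u, v} I Y) {S : FibSheaf.{u, w} I Y} {T : FibSheaf.{u, w} I Y}
    (f : FibHom S T) : FibHom (R.hom S) (R.hom T) where
  app z := LinearMap.compRight ℂ (f.app z)
  hol _ _ hφ := Eventually.mono hφ fun x hx s hs => f.hol x _ (hx s hs)

/-- An open cover of `Y`, indexed by the points of `Y`. Such covers are cofinal among all open
covers. -/
structure PtCover (Y : Type u) [TopologicalSpace Y] where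
  nhd : Y → TopologicalSpace.Opens Y
  mem : ∀ y, y ∈ nhd y

/-- `z` lies in the intersection `U_{σ 0} ∩ … ∩ U_{σ (n-1)}`. -/
def PtCover.Over (U : PtCover Y) {n : ℕ} (σ : Fin n → Y) (z : Y) : Prop :=
  ∀ k, z ∈ U.nhd (σ k)

/-- The common refinement of two covers. -/
def PtCover.inf (U V : PtCover Y) : PtCover Y :=
  ⟨fun y => U.nhd y ⊓ V.nhd y, fun y => ⟨U.mem y, V.mem y⟩⟩

theorem PtCover.Over.left {U V : PtCover Y} {n : ℕ} {σ : Fin n → Y} {z : Y}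
    (h : (U.inf V).Over σ z) : U.Over σ z := fun k => (h k).1

theorem PtCover.Over.right {U V : PtCover Y} {n : ℕ} {σ : Fin n → Y} {z : Y}
    (h : (U.inf V).Over σ z) : V.Over σ z := fun k => (h k).2

theorem PtCover.Over.comp {U : PtCover Y} {n m : ℕ} {σ : Fin n → Y} {z : Y}
    (h : U.Over σ z) (f : Fin m → Fin n) : U.Over (σ ∘ f) z := fun k => h (f k)

theorem PtCover.Over.eventually {U : PtCover Y} {n : ℕ} {σ : Fin n → Y} {z : Y}
    (h : U.Over σ z) : ∀ᶠ x in 𝓝 z, U.Over σ x :=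
  eventually_all.2 fun k => (U.nhd (σ k)).isOpen.mem_nhds (h k)

namespace FibSheaf

variable (S : FibSheaf.{u, v} I Y)

/-- Families indexed by `n`-tuples of points. A cochain on a cover `U` is represented by such a
family; only the values of `c σ` on the intersection `U_σ` matter. -/
abbrev Fam (n : ℕ) : Type (max u v) := (Fin n → Y) → ∀ z, S.fib z

/-- `c` represents a cochain on the cover `U`: each `c σ` is a section over `U_σ`. -/
def IsCochain (U : PtCover Y) {n : ℕ} (c : S.Fam n) : Prop :=
  ∀ σ z, U.Over σ z → c σ ∈ S.HolAt z

/-- Cech `p`-cocycles on some cover. -/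
def cocycles (p : ℕ) : Submodule ℂ (S.Fam (p + 1)) where
  carrier := {c | ∃ U : PtCover Y, S.IsCochain U c ∧ ∀ σ z, U.Over σ z → cechD c σ z = 0}
  zero_mem' := ⟨⟨fun _ => ⊤, fun _ => trivial⟩, fun _ z _ => (S.HolAt z).zero_mem,
    fun σ z _ => by simp [cechD]⟩
  add_mem' := by
    rintro a b ⟨U, hU, hU'⟩ ⟨V, hV, hV'⟩
    refine ⟨U.inf V, fun σ z h => (S.HolAt z).add_mem (hU σ z h.left) (hV σ z h.right),
      fun σ z h => ?_⟩
    have := congrFun (cechD_add a b σ) z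
    rw [Pi.add_apply, hU' σ z h.left, hV' σ z h.right, add_zero] at this
    exact this
  smul_mem' := by
    rintro r a ⟨U, hU, hU'⟩
    refine ⟨U, fun σ z h => (S.HolAt z).smul_mem r (hU σ z h), fun σ z h => ?_⟩
    have := congrFun (cechD_smul r a σ) z
    rw [Pi.smul_apply, hU' σ z h, smul_zero] at this
    exact this

/-- Families that become a Cech coboundary (for `p = 0`: become zero) on some cover. -/
def coboundaries : (p : ℕ) → Submodule ℂ (S.Fam (p + 1))
  | 0 =>
    { carrier := {c | ∃ U : PtCover Y, ∀ σ z, U.Over σ z → c σ z = 0}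
      zero_mem' := ⟨⟨fun _ => ⊤, fun _ => trivial⟩, fun _ _ _ => rfl⟩
      add_mem' := by
        rintro a b ⟨U, hU⟩ ⟨V, hV⟩
        exact ⟨U.inf V, fun σ z h => by simp [hU σ z h.left, hV σ z h.right]⟩
      smul_mem' := by
        rintro r a ⟨U, hU⟩
        exact ⟨U, fun σ z h => by simp [hU σ z h]⟩ }
  | p + 1 =>
    { carrier := {c | ∃ (U : PtCover Y) (e : S.Fam (p + 1)), S.IsCochain U e ∧
        ∀ σ z, U.Over σ z → c σ z = cechD e σ z}
      zero_mem' := ⟨⟨fun _ => ⊤, fun _ => trivial⟩, 0, fun _ z _ => (S.HolAt z).zero_mem,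
        fun σ z _ => by simp [cechD]⟩
      add_mem' := by
        rintro a b ⟨U, e, hU, hU'⟩ ⟨V, e', hV, hV'⟩
        refine ⟨U.inf V, e + e',
          fun σ z h => (S.HolAt z).add_mem (hU σ z h.left) (hV σ z h.right), fun σ z h => ?_⟩
        have := congrFun (cechD_add e e' σ) z
        rw [Pi.add_apply, ← hU' σ z h.left, ← hV' σ z h.right] at this
        exact this.symm
      smul_mem' := by
        rintro r a ⟨U, e, hU, hU'⟩
        refine ⟨U, r • e, fun σ z h => (S.HolAt z).smul_mem r (hU σ z h), fun σ z h => ?_⟩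
        have := congrFun (cechD_smul r e σ) z
        rw [Pi.smul_apply, ← hU' σ z h] at this
        exact this.symm }

/-- Cech cohomology `Ȟᵖ(Y, S) = colim_U Ȟᵖ(U, S)`. The quotient below is this direct limit: two
cocycles on covers `U` and `V` have the same class if and only if, on some common refinement, their
difference is a coboundary. -/
def Coh (p : ℕ) : Type (max u v) := S.cocycles p ⧸ (S.coboundaries p).submoduleOf (S.cocycles p)

instance (p : ℕ) : AddCommGroup (S.Coh p) :=
  inferInstanceAs (AddCommGroup (S.cocycles p ⧸ (S.coboundaries p).submoduleOf (S.cocycles p)))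

instance (p : ℕ) : Module ℂ (S.Coh p) :=
  inferInstanceAs (Module ℂ (S.cocycles p ⧸ (S.coboundaries p).submoduleOf (S.cocycles p)))

/-- The class of a cocycle. -/
def cls (p : ℕ) : S.cocycles p →ₗ[ℂ] S.Coh p :=
  ((S.coboundaries p).submoduleOf (S.cocycles p)).mkQ

theorem cls_surjective (p : ℕ) : Function.Surjective (S.cls p) := Submodule.mkQ_surjective _

/-- Linear maps out of the cohomology. -/
def desc {p : ℕ} {M : Type*} [AddCommGroup M] [Module ℂ M] (φ : S.cocycles p →ₗ[ℂ] M)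
    (h : ∀ c : S.cocycles p, (c : S.Fam (p + 1)) ∈ S.coboundaries p → φ c = 0) :
    S.Coh p →ₗ[ℂ] M :=
  Submodule.liftQ ((S.coboundaries p).submoduleOf (S.cocycles p)) φ fun c hc => h c hc

theorem desc_cls {p : ℕ} {M : Type*} [AddCommGroup M] [Module ℂ M] (φ : S.cocycles p →ₗ[ℂ] M)
    (h : ∀ c : S.cocycles p, (c : S.Fam (p + 1)) ∈ S.coboundaries p → φ c = 0)
    (c : S.cocycles p) : S.desc φ h (S.cls p c) = φ c := rfl

theorem cls_eq_zero {p : ℕ} (c : S.cocycles p) :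
    S.cls p c = 0 ↔ (c : S.Fam (p + 1)) ∈ S.coboundaries p := by
  exact (Submodule.Quotient.mk_eq_zero _).trans Iff.rfl

theorem cls_eq {p : ℕ} (c e : S.cocycles p) :
    S.cls p c = S.cls p e ↔ (c - e : S.Fam (p + 1)) ∈ S.coboundaries p := by
  rw [← sub_eq_zero, ← map_sub, cls_eq_zero]; rfl

/-- A global section as a class of degree `0`. -/
def cls0 (s : ∀ z, S.fib z) (hs : ∀ y, s ∈ S.HolAt y) : S.Coh 0 :=
  S.cls 0 ⟨fun _ => s, ⟨fun _ => ⊤, fun _ => trivial⟩, fun _ z _ => hs z, fun σ z _ => by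
    simp [cechD, Fin.sum_univ_succ]⟩

theorem IsCochain.cechD {U : PtCover Y} {n : ℕ} {c : S.Fam n} (h : S.IsCochain U c) :
    S.IsCochain U (cechD c) := fun σ z hz =>
  cechD_mem (S.HolAt z).toAddSubgroup c σ fun _ => h _ z (hz.comp _)

/-- A change of indices does not change the class. -/
theorem sub_comp_mem (U : PtCover Y) (f : Y → Y) (N : PtCover Y)
    (hN : ∀ y, N.nhd y ≤ U.nhd y ∧ N.nhd y ≤ U.nhd (f y)) {p : ℕ} (c : S.Fam (p + 1))
    (hc : S.IsCochain U c) (hc' : ∀ σ z, U.Over σ z → _root_.cechD c σ z = 0) :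
    (fun σ => c (f ∘ σ) - c σ) ∈ S.coboundaries p := by
  have key : ∀ {n m : ℕ} (σ : Fin n → Y) (z : Y), N.Over σ z → ∀ τ : Fin m → Y,
      (∀ m, ∃ k, τ m = σ k ∨ τ m = f (σ k)) → U.Over τ z := by
    intro n m σ z hz τ hτ k
    obtain ⟨l, hl | hl⟩ := hτ k
    · rw [hl]; exact (hN _).1 (hz l)
    · rw [hl]; exact (hN _).2 (hz l)
  have h0 : ∀ (σ : Fin (p + 1) → Y) (z : Y), N.Over σ z → prism f (_root_.cechD c) σ z = 0 := by
    intro σ z hz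
    let K : AddSubgroup (∀ z, S.fib z) := (Pi.evalAddMonoidHom S.fib z).ker
    exact prism_mem f K _ σ fun τ hτ => hc' τ z (key σ z hz τ hτ)
  have h1 : ∀ (σ : Fin (p + 1) → Y) (z : Y), N.Over σ z →
      c (f ∘ σ) z - c σ z = _root_.cechD (prism f c) σ z := by
    intro σ z hz
    have := congrFun (prism_homotopy f c σ) z
    rw [Pi.add_apply, h0 σ z hz, add_zero] at this
    exact this.symm
  cases p with
  | zero =>
    refine ⟨N, fun σ z hz => (h1 σ z hz).trans ?_⟩
    rw [cechD_zero_len]; rfl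
  | succ p =>
    exact ⟨N, prism f c, fun σ z hz => prism_mem f (S.HolAt z).toAddSubgroup _ σ
      fun τ hτ => hc τ z (key σ z hz τ hτ), h1⟩

end FibSheaf

section Functoriality

variable {S : FibSheaf.{u, v} I Y} {T : FibSheaf.{u, w} I Y}

/-- The effect of a morphism on families. -/
def FibHom.fam (f : FibHom S T) (n : ℕ) : S.Fam n →ₗ[ℂ] T.Fam n where
  toFun c σ z := f.app z (c σ z)
  map_add' c e := by funext σ z; simp
  map_smul' r c := by funext σ z; simp

theorem FibHom.cechD_fam (f : FibHom S T) {n : ℕ} (c : S.Fam n) (σ : Fin (n + 1) → Y) (z : Y) :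
    cechD (f.fam n c) σ z = f.app z (cechD c σ z) := by
  simp [cechD, FibHom.fam, Finset.sum_apply]

theorem FibHom.fam_cocycles (f : FibHom S T) (p : ℕ) :
    S.cocycles p ≤ (T.cocycles p).comap (f.fam (p + 1)) := by
  rintro c ⟨U, hU, hU'⟩
  refine ⟨U, fun σ z h => f.hol z _ (hU σ z h), fun σ z h => ?_⟩
  rw [f.cechD_fam, hU' σ z h, map_zero]

theorem FibHom.fam_coboundaries (f : FibHom S T) (p : ℕ) :
    S.coboundaries p ≤ (T.coboundaries p).comap (f.fam (p + 1)) := by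
  cases p with
  | zero =>
    rintro c ⟨U, hU⟩
    exact ⟨U, fun σ z h => by simp [FibHom.fam, hU σ z h]⟩
  | succ p =>
    rintro c ⟨U, e, hU, hU'⟩
    refine ⟨U, f.fam _ e, fun σ z h => f.hol z _ (hU σ z h), fun σ z h => ?_⟩
    rw [f.cechD_fam, ← hU' σ z h]; rfl

/-- The map induced on cocycles. -/
def FibHom.cocyclesMap (f : FibHom S T) (p : ℕ) : S.cocycles p →ₗ[ℂ] T.cocycles p :=
  (f.fam (p + 1)).restrict (f.fam_cocycles p)

/-- The map induced on Cech cohomology. -/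
def FibHom.cohMap (f : FibHom S T) (p : ℕ) : S.Coh p →ₗ[ℂ] T.Coh p :=
  S.desc (T.cls p ∘ₗ f.cocyclesMap p) fun c hc =>
    (T.cls_eq_zero (f.cocyclesMap p c)).2 (f.fam_coboundaries p hc)

theorem FibHom.cohMap_cls (f : FibHom S T) (p : ℕ) (c : S.cocycles p) :
    f.cohMap p (S.cls p c) = T.cls p (f.cocyclesMap p c) := rfl

end Functoriality

section Connecting

/-- `0 → S' → S → S'' → 0` is a short exact sequence of sheaves, where `S'` carries the structure
induced from `S`. -/
structure FibExact {S' S S'' : FibSheaf.{u, v} I Y} (f : FibHom S' S) (g : FibHom S S'') :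
    Prop where
  inj : ∀ z, Function.Injective (f.app z)
  exact : ∀ z w, g.app z w = 0 ↔ ∃ w', f.app z w' = w
  reflect : ∀ (y : Y) (s : ∀ z, S'.fib z), (fun z => f.app z (s z)) ∈ S.HolAt y → s ∈ S'.HolAt y
  lift : ∀ (y : Y) (t : ∀ z, S''.fib z), t ∈ S''.HolAt y →
    ∃ s ∈ S.HolAt y, ∀ᶠ z in 𝓝 y, g.app z (s z) = t z

variable {S' S S'' : FibSheaf.{u, v} I Y} {f : FibHom S' S} {g : FibHom S S''}

/-- The graph of the connecting homomorphism: lift a cocycle representing `ν` to a cochain `n` with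
values in `S`; the coboundary of `n` comes from a cocycle with values in `S'`, whose class is `μ`. -/
def ConnRel (f : FibHom S' S) (g : FibHom S S'') (p : ℕ) (ν : S''.Coh p) (μ : S'.Coh (p + 1)) :
    Prop :=
  ∃ (c : S''.cocycles p) (b : S'.cocycles (p + 1)) (U : PtCover Y) (n : S.Fam (p + 1)),
    S''.cls p c = ν ∧ S'.cls (p + 1) b = μ ∧ S.IsCochain U n ∧
    (∀ σ z, U.Over σ z → g.app z (n σ z) = (c : S''.Fam (p + 1)) σ z) ∧
    ∀ σ z, U.Over σ z → f.app z ((b : S'.Fam (p + 2)) σ z) = cechD n σ z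

theorem ConnRel.add {p : ℕ} {ν ν' : S''.Coh p} {μ μ' : S'.Coh (p + 1)}
    (h : ConnRel f g p ν μ) (h' : ConnRel f g p ν' μ') :
    ConnRel f g p (ν + ν') (μ + μ') := by
  obtain ⟨c, b, U, n, rfl, rfl, h1, h2, h3⟩ := h
  obtain ⟨c', b', U', n', rfl, rfl, h1', h2', h3'⟩ := h'
  refine ⟨c + c', b + b', U.inf U', n + n', map_add _ _ _, map_add _ _ _,
    fun σ z h => (S.HolAt z).add_mem (h1 σ z h.left) (h1' σ z h.right), fun σ z h => ?_,
    fun σ z h => ?_⟩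
  · simp [h2 σ z h.left, h2' σ z h.right]
  · have := congrFun (cechD_add n n' σ) z
    rw [Pi.add_apply, ← h3 σ z h.left, ← h3' σ z h.right, ← map_add] at this
    exact this.symm

theorem ConnRel.smul {p : ℕ} {ν : S''.Coh p} {μ : S'.Coh (p + 1)} (r : ℂ)
    (h : ConnRel f g p ν μ) : ConnRel f g p (r • ν) (r • μ) := by
  obtain ⟨c, b, U, n, rfl, rfl, h1, h2, h3⟩ := h
  refine ⟨r • c, r • b, U, r • n, map_smul _ _ _, map_smul _ _ _,
    fun σ z h => (S.HolAt z).smul_mem r (h1 σ z h), fun σ z h => ?_, fun σ z h => ?_⟩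
  · simp [h2 σ z h]
  · have := congrFun (cechD_smul r n σ) z
    rw [Pi.smul_apply, ← h3 σ z h, ← map_smul] at this
    exact this.symm

/-- On a paracompact Hausdorff space, cochains lift along a surjection of sheaves, after a change
of indices and a refinement of the cover. -/
theorem FibExact.exists_lift [T2Space Y] [ParacompactSpace Y] (hE : FibExact f g) (U : PtCover Y)
    {n : ℕ} (c : S''.Fam (n + 1)) (hc : S''.IsCochain U c) :
    ∃ (N : PtCover Y) (i : Y → Y) (s : S.Fam (n + 1)),
      (∀ y, N.nhd y ≤ U.nhd y ∧ N.nhd y ≤ U.nhd (i y)) ∧ S.IsCochain N s ∧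
      ∀ σ z, N.Over σ z → g.app z (s σ z) = c (i ∘ σ) z := by
  classical
  obtain ⟨V, hVo, hVu, hVf, hVU⟩ := precise_refinement (fun y => (U.nhd y : Set Y))
    (fun y => (U.nhd y).isOpen) (Set.eq_univ_of_forall fun y => Set.mem_iUnion.2 ⟨y, U.mem y⟩)
  obtain ⟨W, hWu, hWo, hWV⟩ := exists_iUnion_eq_closure_subset hVo (fun x => hVf.point_finite x) hVu
  have hWf : LocallyFinite fun i => closure (W i) := hVf.subset hWV
  choose i hi using fun y => Set.mem_iUnion.1 (hWu.symm ▸ Set.mem_univ y : y ∈ ⋃ j, W j)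
  -- local lifts
  have hl : ∀ (y : Y) (τ : Fin (n + 1) → Y), ∃ s : ∀ z, S.fib z, (∀ k, y ∈ V (τ k)) →
      ∀ᶠ z in 𝓝 y, s ∈ S.HolAt z ∧ g.app z (s z) = c τ z := by
    intro y τ
    by_cases h : ∀ k, y ∈ V (τ k)
    · obtain ⟨s, hs, hs'⟩ := hE.lift y (c τ) (hc τ y fun k => hVU _ (h k))
      exact ⟨s, fun _ => (S.spread hs).and hs'⟩
    · exact ⟨0, fun h' => absurd h' h⟩
  choose l hl using hl
  have hN : ∀ y, ∀ᶠ z in 𝓝 y, z ∈ U.nhd y ∧ z ∈ W (i y) ∧ (∀ j, z ∈ W j → y ∈ V j) ∧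
      ∀ τ : Fin (n + 1) → Y, (∀ k, y ∈ V (τ k)) → l y τ ∈ S.HolAt z ∧ g.app z (l y τ z) = c τ z := by
    intro y
    have h1 : ∀ᶠ z in 𝓝 y, ∀ j, z ∈ W j → y ∈ V j := by
      have hcl : IsClosed (⋃ j : {j // y ∉ V j}, closure (W j)) :=
        (hWf.comp_injective Subtype.val_injective).isClosed_iUnion fun _ => isClosed_closure
      have hy : y ∉ ⋃ j : {j // y ∉ V j}, closure (W j) := by
        rw [Set.mem_iUnion]
        rintro ⟨⟨j, hj⟩, hj'⟩
        exact hj (hWV j hj')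
      filter_upwards [hcl.isOpen_compl.mem_nhds hy] with z hz j hj
      by_contra hcon
      exact hz (Set.mem_iUnion.2 ⟨⟨j, hcon⟩, subset_closure hj⟩)
    have h2 : ∀ᶠ z in 𝓝 y, ∀ τ : Fin (n + 1) → Y, (∀ k, y ∈ V (τ k)) →
        l y τ ∈ S.HolAt z ∧ g.app z (l y τ z) = c τ z := by
      have hfin : {τ : Fin (n + 1) → Y | ∀ k, y ∈ V (τ k)}.Finite := by
        have := Set.Finite.pi' (ι := Fin (n + 1)) (t := fun _ => {j | y ∈ V j})
          fun _ => hVf.point_finite y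
        exact this
      have := (eventually_all_finite hfin (l := 𝓝 y)
        (p := fun τ z => l y τ ∈ S.HolAt z ∧ g.app z (l y τ z) = c τ z)).2 fun τ hτ => hl y τ hτ
      exact this
    filter_upwards [(U.nhd y).isOpen.mem_nhds (U.mem y), (hWo (i y)).mem_nhds (hi y), h1, h2]
      with z a1 a2 a3 a4
    exact ⟨a1, a2, a3, a4⟩
  choose O hO hOo hOm using fun y => eventually_nhds_iff.1 (hN y)
  let N : PtCover Y := ⟨fun y => ⟨O y, hOo y⟩, hOm⟩
  -- the lift on the tuple `σ`
  have hs : ∀ σ : Fin (n + 1) → Y, ∃ s : ∀ z, S.fib z, ∀ z, N.Over σ z →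
      s ∈ S.HolAt z ∧ g.app z (s z) = c (i ∘ σ) z := by
    intro σ
    by_cases hne : ∃ z, N.Over σ z
    · obtain ⟨x, hx⟩ := hne
      refine ⟨l (σ 0) (i ∘ σ), fun z hz => (hO _ z (hz 0)).2.2.2 _ fun k => ?_⟩
      exact (hO _ x (hx 0)).2.2.1 _ (hO _ x (hx k)).2.1
    · exact ⟨0, fun z hz => absurd ⟨z, hz⟩ hne⟩
  choose s hs using hs
  exact ⟨N, i, s, fun y => ⟨fun z hz => (hO y z hz).1, fun z hz =>
    hVU _ (hWV _ (subset_closure (hO y z hz).2.1))⟩, fun σ z h => (hs σ z h).1,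
    fun σ z h => (hs σ z h).2⟩

/-- A cochain in the kernel of `g` comes from `S'`. -/
theorem FibExact.exists_ker (hE : FibExact f g) (U : PtCover Y) {n : ℕ} (x : S.Fam n)
    (hx : S.IsCochain U x) (h0 : ∀ σ z, U.Over σ z → g.app z (x σ z) = 0) :
    ∃ m : S'.Fam n, S'.IsCochain U m ∧ ∀ σ z, U.Over σ z → f.app z (m σ z) = x σ z := by
  have : ∀ σ z, ∃ w, U.Over σ z → f.app z w = x σ z := by
    intro σ z
    by_cases h : U.Over σ z
    · obtain ⟨w, hw⟩ := (hE.exact z _).1 (h0 σ z h)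
      exact ⟨w, fun _ => hw⟩
    · exact ⟨0, fun h' => absurd h' h⟩
  choose m hm using this
  exact ⟨m, fun σ z h => hE.reflect z _ (S.congr
    (h.eventually.mono fun y hy => (hm σ y hy).symm) (hx σ z h)), hm⟩

theorem PtCover.Over.face {U : PtCover Y} {n : ℕ} {σ : Fin (n + 1) → Y} {z : Y}
    (h : U.Over σ z) (k : Fin (n + 1)) : U.Over (σ ∘ k.succAbove) z := h.comp _

theorem cechD_congr {Z A : Type*} [AddCommGroup A] {n : ℕ} {c e : (Fin n → Z) → A}
    {σ : Fin (n + 1) → Z} (h : ∀ k : Fin (n + 1), c (σ ∘ k.succAbove) = e (σ ∘ k.succAbove)) :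
    cechD c σ = cechD e σ := by
  simp [cechD, h]

theorem cechD_eval (S : FibSheaf.{u, v} I Y) {n : ℕ} (c : S.Fam n) (σ : Fin (n + 1) → Y) (z : Y) :
    cechD c σ z = cechD (fun τ => c τ z) σ := by
  simp [cechD, Finset.sum_apply]

theorem cechD_eq_of_over {U : PtCover Y} {n : ℕ} {c e : S.Fam n}
    (h : ∀ σ z, U.Over σ z → c σ z = e σ z) {σ : Fin (n + 1) → Y} {z : Y} (hz : U.Over σ z) :
    cechD c σ z = cechD e σ z := by
  rw [cechD_eval, cechD_eval]
  exact cechD_congr fun k => h _ z (hz.face k)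

theorem FibExact.connRel_total [T2Space Y] [ParacompactSpace Y] (hE : FibExact f g) {p : ℕ}
    (ν : S''.Coh p) : ∃ μ, ConnRel f g p ν μ := by
  obtain ⟨⟨c, U, hU, hU'⟩, rfl⟩ := S''.cls_surjective p ν
  obtain ⟨N, i, s, hN, hs, hs'⟩ := hE.exists_lift U c hU
  have hi : ∀ {n : ℕ} (σ : Fin n → Y) z, N.Over σ z → U.Over (i ∘ σ) z :=
    fun σ z h k => (hN _).2 (h k)
  have hci : (fun σ => c (i ∘ σ)) ∈ S''.cocycles p :=
    ⟨N, fun σ z h => hU _ z (hi σ z h), fun σ z h => hU' (i ∘ σ) z (hi σ z h)⟩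
  obtain ⟨b, hb, hb'⟩ := hE.exists_ker N (cechD s) (FibSheaf.IsCochain.cechD S hs) fun σ z h => by
    rw [← g.cechD_fam]
    exact (cechD_eq_of_over (U := N) hs' h).trans (hU' (i ∘ σ) z (hi σ z h))
  have hbc : b ∈ S'.cocycles (p + 1) := by
    refine ⟨N, hb, fun σ z h => hE.inj z ?_⟩
    rw [← f.cechD_fam, map_zero]
    refine (cechD_eq_of_over (U := N) hb' h).trans ?_
    rw [cechD_cechD]; rfl
  refine ⟨S'.cls (p + 1) ⟨b, hbc⟩, ⟨_, hci⟩, ⟨b, hbc⟩, N, s, ?_, rfl, hs, hs', hb'⟩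
  rw [FibSheaf.cls_eq]
  exact S''.sub_comp_mem U i N hN c hU hU'

theorem FibExact.connRel_zero [T2Space Y] [ParacompactSpace Y] (hE : FibExact f g) {p : ℕ}
    {μ : S'.Coh (p + 1)} (h : ConnRel f g p 0 μ) : μ = 0 := by
  obtain ⟨⟨c, hc⟩, ⟨b, V, hV, hV'⟩, U, n, h0, rfl, hn, hn', hb⟩ := h
  rw [FibSheaf.cls_eq_zero] at h0 ⊢
  change b ∈ S'.coboundaries (p + 1)
  replace h0 : c ∈ S''.coboundaries p := h0
  replace hn' : ∀ σ z, U.Over σ z → g.app z (n σ z) = c σ z := hn'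
  replace hb : ∀ σ z, U.Over σ z → f.app z (b σ z) = cechD n σ z := hb
  cases p with
  | zero =>
    obtain ⟨W, hW⟩ := h0
    obtain ⟨m, hm, hm'⟩ := hE.exists_ker (U.inf W) n (fun σ z h => hn σ z h.left)
      fun σ z h => (hn' σ z h.left).trans (hW σ z h.right)
    refine ⟨U.inf W, m, hm, fun σ z h => hE.inj z ?_⟩
    rw [hb σ z h.left, ← f.cechD_fam]
    exact (cechD_eq_of_over (U := U.inf W) hm' h).symm
  | succ p =>
    obtain ⟨W, e, he, he'⟩ := h0
    obtain ⟨N, i, s, hN, hs, hs'⟩ := hE.exists_lift ((U.inf V).inf W) e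
      fun σ z h => he σ z h.right
    have hi : ∀ {n : ℕ} (σ : Fin n → Y) z, N.Over σ z → ((U.inf V).inf W).Over (i ∘ σ) z :=
      fun σ z h k => (hN _).2 (h k)
    obtain ⟨m, hm, hm'⟩ := hE.exists_ker N (fun σ => n (i ∘ σ) - cechD s σ)
      (fun σ z h => (S.HolAt z).sub_mem (hn _ z (hi σ z h).left.left)
        (FibSheaf.IsCochain.cechD S hs σ z h)) fun σ z h => by
          have : g.app z (cechD s σ z) = cechD e (i ∘ σ) z := by
            rw [← g.cechD_fam]
            exact cechD_eq_of_over (U := N) hs' h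
          rw [Pi.sub_apply, map_sub, hn' _ z (hi σ z h).left.left, this,
            he' _ z (hi σ z h).right, sub_self]
    have h1 : (fun σ => b (i ∘ σ)) ∈ S'.coboundaries (p + 1 + 1) := by
      refine ⟨N, m, hm, fun σ z h => hE.inj z ?_⟩
      rw [hb _ z (hi σ z h).left.left, ← f.cechD_fam]
      refine Eq.trans ?_ (cechD_eq_of_over (U := N) hm' h).symm
      have := congrFun (cechD_sub (fun σ => n (i ∘ σ)) (cechD s) σ) z
      rw [cechD_cechD, sub_zero] at this
      exact this.symm
    have h2 := S'.sub_comp_mem V i N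
      (fun y => ⟨(hN y).1.trans fun z hz => hz.1.2, (hN y).2.trans fun z hz => hz.1.2⟩) b hV hV'
    have h3 := Submodule.sub_mem _ h1 h2
    convert h3 using 1
    funext σ
    simp

theorem FibExact.connRel_unique [T2Space Y] [ParacompactSpace Y] (hE : FibExact f g) {p : ℕ}
    {ν : S''.Coh p} {μ μ' : S'.Coh (p + 1)} (h : ConnRel f g p ν μ) (h' : ConnRel f g p ν μ') :
    μ = μ' := by
  have := h.add (h'.smul (-1))
  rw [neg_one_smul, neg_one_smul, add_neg_cancel] at this
  exact add_neg_eq_zero.1 (hE.connRel_zero this)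

/-- The connecting homomorphism `Hᵖ(Y, S'') → Hᵖ⁺¹(Y, S')` of a short exact sequence. -/
def FibExact.conn [T2Space Y] [ParacompactSpace Y] (hE : FibExact f g) (p : ℕ) :
    S''.Coh p →ₗ[ℂ] S'.Coh (p + 1) where
  toFun ν := (hE.connRel_total ν).choose
  map_add' ν ν' := hE.connRel_unique (hE.connRel_total (ν + ν')).choose_spec
    ((hE.connRel_total ν).choose_spec.add (hE.connRel_total ν').choose_spec)
  map_smul' r ν := hE.connRel_unique (hE.connRel_total (r • ν)).choose_spec
    ((hE.connRel_total ν).choose_spec.smul r)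

theorem FibExact.conn_spec [T2Space Y] [ParacompactSpace Y] (hE : FibExact f g) {p : ℕ}
    (ν : S''.Coh p) : ConnRel f g p ν (hE.conn p ν) := (hE.connRel_total ν).choose_spec

end Connecting

section Cup

/-- An `𝒪_Y`-bilinear pairing of sheaves, given fibrewise. -/
structure FibPairing (P : FibSheaf.{u, v} I Y) (S T : FibSheaf.{u, w} I Y) where
  app : ∀ z, P.fib z →ₗ[ℂ] S.fib z →ₗ[ℂ] T.fib z
  hol : ∀ (y : Y) (a : ∀ z, P.fib z) (s : ∀ z, S.fib z), a ∈ P.HolAt y → s ∈ S.HolAt y →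
    (fun z => app z (a z) (s z)) ∈ T.HolAt y

variable {P : FibSheaf.{u, v} I Y} {S T : FibSheaf.{u, w} I Y} (m : FibPairing P S T)

/-- The product of a `1`-cochain `θ` and a `p`-cochain `c`:
`(θ ⌣ c)(i₀,…,i_{p+1}) = ⟨θ(i₀,i₁), c(i₁,…,i_{p+1})⟩`. -/
def FibPairing.cupFam (p : ℕ) : P.Fam 2 →ₗ[ℂ] S.Fam (p + 1) →ₗ[ℂ] T.Fam (p + 2) :=
  LinearMap.mk₂ ℂ (fun θ c σ z => m.app z (θ ![σ 0, σ 1] z) (c (Fin.tail σ) z))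
    (fun _ _ _ => by funext σ z; simp) (fun _ _ _ => by funext σ z; simp)
    (fun _ _ _ => by funext σ z; simp) (fun _ _ _ => by funext σ z; simp)

theorem FibPairing.cechD_cupFam (p : ℕ) (θ : P.Fam 2) (c : S.Fam (p + 1)) (σ : Fin (p + 3) → Y)
    (z : Y) : cechD (m.cupFam p θ c) σ z =
      m.app z (cechD θ ![σ 0, σ 1, σ 2] z) (c (Fin.tail (Fin.tail σ)) z) -
        m.app z (θ ![σ 0, σ 1] z) (cechD c (Fin.tail σ) z) := by
  simp only [cechD_eval]
  exact cechD_cup1 (LinearMap.toAddMonoidHom'.comp (m.app z).toAddMonoidHom)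
    (fun τ => θ τ z) (fun τ => c τ z) σ

theorem PtCover.Over.tail {U : PtCover Y} {n : ℕ} {σ : Fin (n + 1) → Y} {z : Y}
    (h : U.Over σ z) : U.Over (Fin.tail σ) z := fun k => h k.succ

theorem PtCover.Over.pair {U : PtCover Y} {n : ℕ} {σ : Fin (n + 2) → Y} {z : Y}
    (h : U.Over σ z) : U.Over ![σ 0, σ 1] z := fun k => by
  fin_cases k
  · exact h 0
  · exact h 1

theorem PtCover.Over.triple {U : PtCover Y} {n : ℕ} {σ : Fin (n + 3) → Y} {z : Y}
    (h : U.Over σ z) : U.Over ![σ 0, σ 1, σ 2] z := fun k => by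
  fin_cases k
  · exact h 0
  · exact h 1
  · exact h 2

theorem FibPairing.cupFam_mem (p : ℕ) (θ : P.cocycles 1) (c : S.Fam (p + 1))
    (hc : c ∈ S.cocycles p) : m.cupFam p θ c ∈ T.cocycles (p + 1) := by
  obtain ⟨θ, U, hU, hU'⟩ := θ
  obtain ⟨V, hV, hV'⟩ := hc
  refine ⟨U.inf V, fun σ z h => m.hol z _ _ (hU _ z h.left.pair) (hV _ z h.right.tail),
    fun σ z h => ?_⟩
  rw [m.cechD_cupFam, hU' _ z h.left.triple, hV' _ z h.right.tail]
  simp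

/-- The product with a fixed `1`-cocycle. -/
def FibPairing.cupCocycles (p : ℕ) (θ : P.cocycles 1) : S.cocycles p →ₗ[ℂ] T.cocycles (p + 1) :=
  (m.cupFam p θ).restrict (m.cupFam_mem p θ)

theorem FibPairing.cup_coboundaries_right (p : ℕ) (θ : P.cocycles 1) (c : S.cocycles p)
    (hc : (c : S.Fam (p + 1)) ∈ S.coboundaries p) :
    m.cupFam p θ c ∈ T.coboundaries (p + 1) := by
  obtain ⟨θ, U, hU, hU'⟩ := θ
  cases p with
  | zero =>
    obtain ⟨V, hV⟩ := hc
    refine ⟨V, 0, fun σ z _ => (T.HolAt z).zero_mem, fun σ z h => ?_⟩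
    rw [cechD_eval]
    simp [cupFam, hV _ z h.tail, cechD]
  | succ p =>
    obtain ⟨V, e, he, he'⟩ := hc
    refine ⟨U.inf V, - m.cupFam p θ e, fun σ z h => (T.HolAt z).neg_mem
      (m.hol z _ _ (hU _ z h.left.pair) (he _ z h.right.tail)), fun σ z h => ?_⟩
    have h1 := m.cechD_cupFam p θ e σ z
    rw [hU' _ z h.left.triple, map_zero, LinearMap.zero_apply, zero_sub,
      ← he' _ z h.right.tail] at h1
    have h2 : cechD (-m.cupFam p θ e) σ z = - cechD (m.cupFam p θ e) σ z := by
      simp [cechD, Finset.sum_apply]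
    rw [h2, h1, neg_neg]; rfl

theorem FibPairing.cup_coboundaries_left (p : ℕ) (θ : P.cocycles 1) (c : S.cocycles p)
    (hθ : (θ : P.Fam 2) ∈ P.coboundaries 1) :
    m.cupFam p θ c ∈ T.coboundaries (p + 1) := by
  obtain ⟨c, V, hV, hV'⟩ := c
  obtain ⟨U, ε, hε, hε'⟩ := hθ
  refine ⟨U.inf V, fun σ z => m.app z (ε ![σ 0] z) (c σ z), fun σ z h =>
    m.hol z _ _ (hε _ z fun k => ?_) (hV _ z h.right), fun σ z h => ?_⟩
  · fin_cases k; exact h.left 0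
  · have := cechD_cup0 (LinearMap.toAddMonoidHom'.comp (m.app z).toAddMonoidHom)
      (fun τ => ε τ z) (fun τ => c τ z) σ
    rw [cechD_eval]
    refine Eq.trans ?_ this.symm
    have h2 : cechD (fun τ => c τ z) σ = 0 := (cechD_eval S c σ z).symm.trans (hV' σ z h.right)
    rw [h2, map_zero, add_zero]
    have h3 := hε' ![σ 0, σ 1] z h.left.pair
    rw [cechD_eval] at h3
    simp only [cup1, ← h3]
    rfl

/-- The cup product `H¹(Y, P) × Hᵖ(Y, S) → Hᵖ⁺¹(Y, T)` induced by a pairing. -/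
def FibPairing.cup (p : ℕ) : P.Coh 1 →ₗ[ℂ] S.Coh p →ₗ[ℂ] T.Coh (p + 1) :=
  P.desc
    { toFun := fun θ => S.desc (T.cls (p + 1) ∘ₗ m.cupCocycles p θ) fun c hc =>
        (T.cls_eq_zero (m.cupCocycles p θ c)).2 (m.cup_coboundaries_right p θ c hc)
      map_add' := fun θ θ' => by
        refine LinearMap.ext fun x => ?_
        obtain ⟨c, rfl⟩ := S.cls_surjective p x
        refine Eq.trans ?_ ((T.cls (p + 1)).map_add (m.cupCocycles p θ c) (m.cupCocycles p θ' c))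
        refine congrArg (T.cls (p + 1)) (Subtype.ext ?_)
        exact LinearMap.congr_fun ((m.cupFam p).map_add (θ : P.Fam 2) θ') (c : S.Fam (p + 1))
      map_smul' := fun r θ => by
        refine LinearMap.ext fun x => ?_
        obtain ⟨c, rfl⟩ := S.cls_surjective p x
        refine Eq.trans ?_ ((T.cls (p + 1)).map_smul r (m.cupCocycles p θ c))
        refine congrArg (T.cls (p + 1)) (Subtype.ext ?_)
        exact LinearMap.congr_fun ((m.cupFam p).map_smul r (θ : P.Fam 2)) (c : S.Fam (p + 1)) }
    fun θ hθ => by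
      refine LinearMap.ext fun x => ?_
      obtain ⟨c, rfl⟩ := S.cls_surjective p x
      exact (T.cls_eq_zero _).2 (m.cup_coboundaries_left p θ c hθ)

theorem FibPairing.cup_cls (p : ℕ) (θ : P.cocycles 1) (c : S.cocycles p) :
    m.cup p (P.cls 1 θ) (S.cls p c) = T.cls (p + 1) (m.cupCocycles p θ c) := rfl

end Cup

end Sheaves

/-! ### Exterior powers -/

section Exterior

open exteriorPower

variable {V W X : Type*} [AddCommGroup V] [Module ℂ V] [AddCommGroup W] [Module ℂ W]
  [AddCommGroup X] [Module ℂ X]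

/-- The wedge product `⋀ᵇ V × ⋀ᵃ V → ⋀ʲ V`, `j = b + a`. -/
def wedgeMul {b a j : ℕ} (h : b + a = j) : ⋀[ℂ]^b V →ₗ[ℂ] ⋀[ℂ]^a V →ₗ[ℂ] ⋀[ℂ]^j V :=
  LinearMap.mk₂ ℂ
    (fun x y => ⟨(x : ExteriorAlgebra ℂ V) * y, by
      have := Submodule.mul_mem_mul x.2 y.2
      rwa [← pow_add, h] at this⟩)
    (fun x x' y => Subtype.ext (by simp [add_mul])) (fun r x y => Subtype.ext (by simp))
    (fun x y y' => Subtype.ext (by simp [mul_add])) (fun r x y => Subtype.ext (by simp))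

/-- Concatenation of tuples. -/
def catTuple {b a j : ℕ} (h : b + a = j) {V : Type*} (u : Fin b → V) (v : Fin a → V) : Fin j → V :=
  Fin.append u v ∘ Fin.cast h.symm

theorem wedgeMul_ιMulti {b a j : ℕ} (h : b + a = j) (u : Fin b → V) (v : Fin a → V) :
    wedgeMul h (ιMulti ℂ b u) (ιMulti ℂ a v) = ιMulti ℂ j (catTuple h u v) := by
  subst h
  refine Subtype.ext ?_
  change ExteriorAlgebra.ιMulti ℂ b u * ExteriorAlgebra.ιMulti ℂ a v
    = ExteriorAlgebra.ιMulti ℂ (b + a) (Fin.append u v)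
  rw [ExteriorAlgebra.ιMulti_apply, ExteriorAlgebra.ιMulti_apply, ExteriorAlgebra.ιMulti_apply,
    ← List.prod_append]
  congr 1
  rw [← List.ofFn_fin_append]
  congr 1
  funext m
  refine Fin.addCases (fun m => ?_) (fun m => ?_) m <;> simp

/-- For a subspace `i : W → V`, the `k`-th step `F_k` of the induced filtration of `⋀ʲ V`: the span
of the products `v₁ ∧ … ∧ vⱼ` with `v₁, …, vₖ ∈ W`; it is zero for `k > j`. -/
def extFilt (i : W →ₗ[ℂ] V) (j k : ℕ) : Submodule ℂ (⋀[ℂ]^j V) :=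
  Submodule.span ℂ {w | k ≤ j ∧ ∃ v : Fin j → V,
    (∀ m : Fin j, (m : ℕ) < k → v m ∈ LinearMap.range i) ∧ w = ιMulti ℂ j v}

theorem extFilt_succ_le (i : W →ₗ[ℂ] V) (j k : ℕ) : extFilt i j (k + 1) ≤ extFilt i j k := by
  refine Submodule.span_mono ?_
  rintro w ⟨hk, v, hv, rfl⟩
  exact ⟨by omega, v, fun m hm => hv m (by omega), rfl⟩

theorem ιMulti_cat_mem_extFilt (i : W →ₗ[ℂ] V) {b a j : ℕ} (h : b + a = j) (u : Fin b → W)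
    (v : Fin a → V) : ιMulti ℂ j (catTuple h (i ∘ u) v) ∈ extFilt i j b := by
  refine Submodule.subset_span ⟨by omega, _, fun m hm => ?_, rfl⟩
  subst h
  exact ⟨u ⟨m, hm⟩, by simp [catTuple, Fin.append, Fin.addCases, hm]; rfl⟩

theorem extFilt_induction (i : W →ₗ[ℂ] V) {b a j : ℕ} (h : b + a = j)
    (Q : Submodule ℂ (⋀[ℂ]^j V))
    (hQ : ∀ (u : Fin b → W) (v : Fin a → V), ιMulti ℂ j (catTuple h (i ∘ u) v) ∈ Q) :
    extFilt i j b ≤ Q := by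
  refine Submodule.span_le.2 ?_
  rintro w ⟨_, v, hv, rfl⟩
  subst h
  choose u hu using fun m : Fin b => hv (Fin.castAdd a m) m.2
  have := hQ u (fun m => v (Fin.natAdd b m))
  have e : catTuple rfl (i ∘ u) (fun m => v (Fin.natAdd b m)) = v := by
    funext m
    refine Fin.addCases (fun m => ?_) (fun m => ?_) m <;> simp [catTuple, hu]
  rwa [e] at this

/-- A membership criterion: some further entry lies in the subspace. -/
theorem ιMulti_cat_mem_extFilt_succ (i : W →ₗ[ℂ] V) {b a j : ℕ} (h : b + a = j) (u : Fin b → W)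
    (v : Fin a → V) (l : Fin a) (hl : v l ∈ LinearMap.range i) :
    ιMulti ℂ j (catTuple h (i ∘ u) v) ∈ extFilt i j (b + 1) := by
  subst h
  set t := catTuple rfl (i ∘ u) v with ht
  have ha : 0 < a := l.pos
  let p : Fin (b + a) := Fin.natAdd b ⟨0, ha⟩
  let q : Fin (b + a) := Fin.natAdd b l
  have key : ιMulti ℂ (b + a) (t ∘ Equiv.swap p q) ∈ extFilt i (b + a) (b + 1) := by
    refine Submodule.subset_span ⟨by omega, _, fun m hm => ?_, rfl⟩
    rcases Nat.lt_succ_iff_lt_or_eq.1 hm with hm' | hm'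
    · have h1 : m ≠ p := fun hh => by rw [hh] at hm'; simp [p] at hm'
      have h2 : m ≠ q := fun hh => by rw [hh] at hm'; simp [q] at hm'
      simp only [Function.comp_apply, Equiv.swap_apply_of_ne_of_ne h1 h2]
      exact ⟨u ⟨m, hm'⟩, by simp [ht, catTuple, Fin.append, Fin.addCases, hm']; rfl⟩
    · have : m = p := Fin.ext (by simp [p, hm'])
      rw [this]
      simp only [Function.comp_apply, Equiv.swap_apply_left]
      simpa [ht, catTuple, q] using hl
  rw [AlternatingMap.map_perm] at key
  rcases Int.units_eq_one_or (Equiv.Perm.sign (Equiv.swap p q)) with hs | hs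
  · rwa [hs, one_smul] at key
  · rw [hs] at key
    simpa using key

theorem ιMulti_cat_sub_mem (i : W →ₗ[ℂ] V) {b a j : ℕ} (h : b + a = j) (u : Fin b → W)
    (v v' : Fin a → V) (hv : ∀ l, v l - v' l ∈ LinearMap.range i) :
    ιMulti ℂ j (catTuple h (i ∘ u) v) - ιMulti ℂ j (catTuple h (i ∘ u) v')
      ∈ extFilt i j (b + 1) := by
  classical
  have key : ∀ s : Finset (Fin a), ιMulti ℂ j (catTuple h (i ∘ u) (s.piecewise v v')) -
      ιMulti ℂ j (catTuple h (i ∘ u) v') ∈ extFilt i j (b + 1) := by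
    intro s
    induction s using Finset.induction with
    | empty => simp
    | insert l s hl ih =>
      have hcat : ∀ (w : Fin a → V) (x : V), ιMulti ℂ j (catTuple h (i ∘ u) (Function.update w l x))
          = wedgeMul h (ιMulti ℂ b (i ∘ u)) (ιMulti ℂ a (Function.update w l x)) :=
        fun w x => (wedgeMul_ιMulti h _ _).symm
      have e1 : (insert l s).piecewise v v' = Function.update (s.piecewise v v') l (v l) :=
        Finset.piecewise_insert _ _ _ _
      have e2 : s.piecewise v v' = Function.update (s.piecewise v v') l (v' l) := by
        rw [eq_comm, Function.update_eq_self_iff]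
        simp [hl]
      have h1 : ιMulti ℂ j (catTuple h (i ∘ u) ((insert l s).piecewise v v')) -
          ιMulti ℂ j (catTuple h (i ∘ u) (s.piecewise v v')) ∈ extFilt i j (b + 1) := by
        rw [e1]
        nth_rewrite 2 [e2]
        rw [hcat, hcat, ← map_sub, ← AlternatingMap.map_update_sub, ← hcat]
        exact ιMulti_cat_mem_extFilt_succ i h u _ l (by simpa using hv l)
      have := Submodule.add_mem _ h1 ih
      rwa [sub_add_sub_cancel] at this
  simpa using key Finset.univ

/-- The component `⋀ʲ V → ⋀ᵇ W ⊗ ⋀ᵃ X` of the comultiplication, along maps `r : V → W` and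
`pr : V → X`. -/
def coprodMap {b a j : ℕ} (h : b + a = j) (r : V →ₗ[ℂ] W) (pr : V →ₗ[ℂ] X) :
    ⋀[ℂ]^j V →ₗ[ℂ] ⋀[ℂ]^b W ⊗[ℂ] ⋀[ℂ]^a X :=
  alternatingMapLinearEquiv (R := ℂ) (M := V) (N := ⋀[ℂ]^b W ⊗[ℂ] ⋀[ℂ]^a X) (n := j)
    ((AlternatingMap.domCoprod ((ιMulti ℂ b).compLinearMap r)
      ((ιMulti ℂ a).compLinearMap pr)).domDomCongr (finSumFinEquiv.trans (finCongr h)))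

theorem coprodMap_ιMulti {b a j : ℕ} (h : b + a = j) (r : V →ₗ[ℂ] W) (pr : V →ₗ[ℂ] X)
    (t : Fin j → V) : coprodMap h r pr (ιMulti ℂ j t) =
      ∑ σ : Equiv.Perm.ModSumCongr (Fin b) (Fin a), ((Equiv.Perm.sign σ.out : ℤ) : ℂ) •
        (ιMulti ℂ b (fun l => r (t (finCongr h (finSumFinEquiv (σ.out (Sum.inl l)))))) ⊗ₜ[ℂ]
          ιMulti ℂ a fun l => pr (t (finCongr h (finSumFinEquiv (σ.out (Sum.inr l)))))) := by
  rw [coprodMap, alternatingMapLinearEquiv_apply_ιMulti]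
  change (∑ σ : Equiv.Perm.ModSumCongr (Fin b) (Fin a),
    AlternatingMap.domCoprod.summand _ _ σ) (fun m => t (finCongr h (finSumFinEquiv m))) = _
  rw [_root_.sum_apply]
  refine Finset.sum_congr rfl fun σ _ => ?_
  have := congrFun (congrArg DFunLike.coe (AlternatingMap.domCoprod.summand_mk''
    ((ιMulti ℂ b).compLinearMap r) ((ιMulti ℂ a).compLinearMap pr) σ.out))
    (fun m => t (finCongr h (finSumFinEquiv m)))
  rw [Quotient.out_eq'] at this
  rw [this]
  rcases Int.units_eq_one_or (Equiv.Perm.sign σ.out) with hσ | hσ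
  · rw [hσ]; simp [MultilinearMap.domCoprod_apply]
  · rw [hσ]; simp; rfl

theorem coprodMap_cat {b a j : ℕ} (h : b + a = j) (i : W →ₗ[ℂ] V) (r : V →ₗ[ℂ] W)
    (pr : V →ₗ[ℂ] X) (hr : ∀ w, r (i w) = w) (hpr : ∀ w, pr (i w) = 0) (u : Fin b → W)
    (v : Fin a → V) :
    coprodMap h r pr (ιMulti ℂ j (catTuple h (i ∘ u) v)) =
      ιMulti ℂ b u ⊗ₜ[ℂ] ιMulti ℂ a (pr ∘ v) := by
  classical
  subst h
  rw [coprodMap, alternatingMapLinearEquiv_apply_ιMulti]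
  simp only [AlternatingMap.domDomCongr_apply]
  have ht : (fun m => catTuple rfl (i ∘ u) v ((finSumFinEquiv.trans (finCongr rfl)) m)) =
      Sum.elim (i ∘ u) v := by
    funext m
    rcases m with m | m <;> simp [catTuple]
  change (AlternatingMap.domCoprod _ _) (fun m => catTuple rfl (i ∘ u) v
    ((finSumFinEquiv.trans (finCongr rfl)) m)) = _
  rw [ht]
  change (∑ σ : Equiv.Perm.ModSumCongr (Fin b) (Fin a),
    AlternatingMap.domCoprod.summand _ _ σ) (Sum.elim (i ∘ u) v) = _
  rw [_root_.sum_apply]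
  refine (Finset.sum_eq_single (Quotient.mk'' 1) ?_ ?_).trans ?_
  · intro σ _ hσ
    induction σ using Quotient.inductionOn' with | _ σ
    rw [AlternatingMap.domCoprod.summand_mk'']
    have : ∃ m, ∃ l, σ (Sum.inr m) = Sum.inl l := by
      by_contra hcon
      push Not at hcon
      refine hσ (Quotient.sound' ?_)
      rw [QuotientGroup.leftRel_apply]
      have hmem : σ ∈ (Equiv.Perm.sumCongrHom (Fin b) (Fin a)).range := by
        refine Equiv.Perm.mem_sumCongrHom_range_of_perm_mapsTo_inl
          ((Equiv.Perm.perm_mapsTo_inl_iff_mapsTo_inr σ).2 ?_)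
        rintro _ ⟨m, rfl⟩
        rcases hm : σ (Sum.inr m) with l | l
        · exact absurd hm (hcon m l)
        · exact ⟨l, rfl⟩
      simpa using Subgroup.inv_mem _ hmem
    obtain ⟨m, l, hm⟩ := this
    have h0 : (ιMulti ℂ a) (fun m => pr (Sum.elim (i ∘ u) v (σ (Sum.inr m)))) = 0 :=
      AlternatingMap.map_coord_zero _ m (by simp [hm, hpr])
    simp only [Function.comp_def] at h0
    simp [MultilinearMap.domCoprod_apply, Function.comp_def, h0]
  · simp
  · rw [AlternatingMap.domCoprod.summand_mk'']
    simp [MultilinearMap.domCoprod_apply, Function.comp_def, hr]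

/-- The symbol map `F_b → ⋀ᵇ W ⊗ ⋀ᵃ X`, with kernel `F_{b+1}`, for an exact sequence
`0 → W → V → X → 0` of vector spaces. It is the unique linear map with
`i w₁ ∧ … ∧ i w_b ∧ v₁ ∧ … ∧ v_a ↦ (w₁ ∧ … ∧ w_b) ⊗ (pr v₁ ∧ … ∧ pr v_a)`. -/
def extSymbol {b a j : ℕ} (h : b + a = j) (i : W →ₗ[ℂ] V) (pr : V →ₗ[ℂ] X)
    (hi : Function.Injective i) : extFilt i j b →ₗ[ℂ] ⋀[ℂ]^b W ⊗[ℂ] ⋀[ℂ]^a X :=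
  coprodMap h (i.exists_leftInverse_of_injective (LinearMap.ker_eq_bot.2 hi)).choose pr ∘ₗ
    (extFilt i j b).subtype

theorem extSymbol_cat {b a j : ℕ} (h : b + a = j) (i : W →ₗ[ℂ] V) (pr : V →ₗ[ℂ] X)
    (hi : Function.Injective i) (hpr : ∀ w, pr (i w) = 0) (u : Fin b → W) (v : Fin a → V) :
    extSymbol h i pr hi ⟨ιMulti ℂ j (catTuple h (i ∘ u) v), ιMulti_cat_mem_extFilt i h u v⟩ =
      ιMulti ℂ b u ⊗ₜ[ℂ] ιMulti ℂ a (pr ∘ v) :=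
  coprodMap_cat h i _ pr (fun w => LinearMap.congr_fun
    (i.exists_leftInverse_of_injective (LinearMap.ker_eq_bot.2 hi)).choose_spec w) hpr u v

theorem extSymbol_eq {b a j : ℕ} (h : b + a = j) (i : W →ₗ[ℂ] V) (r : V →ₗ[ℂ] W) (pr : V →ₗ[ℂ] X)
    (hi : Function.Injective i) (hr : ∀ w, r (i w) = w) (hpr : ∀ w, pr (i w) = 0)
    (w : extFilt i j b) : extSymbol h i pr hi w = coprodMap h r pr w := by
  let r' := (i.exists_leftInverse_of_injective (LinearMap.ker_eq_bot.2 hi)).choose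
  have := extFilt_induction i h (LinearMap.eqLocus (coprodMap h r' pr) (coprodMap h r pr))
    fun u v => by
      rw [LinearMap.mem_eqLocus, coprodMap_cat h i r pr hr hpr]
      exact coprodMap_cat h i r' pr (fun w => LinearMap.congr_fun
        (i.exists_leftInverse_of_injective (LinearMap.ker_eq_bot.2 hi)).choose_spec w) hpr u v
  exact this w.2

/-- The map `⋀ᵇ W ⊗ ⋀ᵃ X → F_b` defined by a section `s` of `V → X`. -/
def extLift {b a j : ℕ} (h : b + a = j) (i : W →ₗ[ℂ] V) (s : X →ₗ[ℂ] V) :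
    ⋀[ℂ]^b W ⊗[ℂ] ⋀[ℂ]^a X →ₗ[ℂ] ⋀[ℂ]^j V :=
  TensorProduct.lift ((wedgeMul h).compl₁₂ (exteriorPower.map b i) (exteriorPower.map a s))

theorem extLift_tmul {b a j : ℕ} (h : b + a = j) (i : W →ₗ[ℂ] V) (s : X →ₗ[ℂ] V)
    (u : Fin b → W) (x : Fin a → X) :
    extLift h i s (ιMulti ℂ b u ⊗ₜ[ℂ] ιMulti ℂ a x) =
      ιMulti ℂ j (catTuple h (i ∘ u) (s ∘ x)) := by
  simp [extLift, map_apply_ιMulti, wedgeMul_ιMulti]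

theorem ext_tensor_induction {b a : ℕ} (Q : Submodule ℂ (⋀[ℂ]^b W ⊗[ℂ] ⋀[ℂ]^a X))
    (hQ : ∀ (u : Fin b → W) (x : Fin a → X), ιMulti ℂ b u ⊗ₜ[ℂ] ιMulti ℂ a x ∈ Q) : Q = ⊤ := by
  rw [eq_top_iff]
  rintro t -
  induction t using TensorProduct.induction_on with
  | zero => exact Q.zero_mem
  | add x y hx hy => exact Q.add_mem hx hy
  | tmul x y =>
    have hx : x ∈ Submodule.span ℂ (Set.range (ιMulti ℂ b (M := W))) := by
      rw [ιMulti_span]; trivial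
    have hy : y ∈ Submodule.span ℂ (Set.range (ιMulti ℂ a (M := X))) := by
      rw [ιMulti_span]; trivial
    induction hx using Submodule.span_induction with
    | zero => simp
    | add x x' _ _ h h' => rw [TensorProduct.add_tmul]; exact Q.add_mem h h'
    | smul r x _ h => rw [← TensorProduct.smul_tmul']; exact Q.smul_mem r h
    | mem x hx =>
      obtain ⟨u, rfl⟩ := hx
      induction hy using Submodule.span_induction with
      | zero => simp
      | add x x' _ _ h h' => rw [TensorProduct.tmul_add]; exact Q.add_mem h h'
      | smul r x _ h => rw [TensorProduct.tmul_smul]; exact Q.smul_mem r h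
      | mem y hy => obtain ⟨x, rfl⟩ := hy; exact hQ u x

theorem extLift_mem {b a j : ℕ} (h : b + a = j) (i : W →ₗ[ℂ] V) (s : X →ₗ[ℂ] V)
    (t : ⋀[ℂ]^b W ⊗[ℂ] ⋀[ℂ]^a X) : extLift h i s t ∈ extFilt i j b := by
  have := ext_tensor_induction ((extFilt i j b).comap (extLift h i s)) fun u x => by
    rw [Submodule.mem_comap, extLift_tmul]
    exact ιMulti_cat_mem_extFilt i h u _
  exact (this ▸ Submodule.mem_top : t ∈ (extFilt i j b).comap (extLift h i s))

theorem extSymbol_extLift {b a j : ℕ} (h : b + a = j) (i : W →ₗ[ℂ] V) (pr : V →ₗ[ℂ] X)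
    (hi : Function.Injective i) (hpr : ∀ w, pr (i w) = 0) (s : X →ₗ[ℂ] V) (hs : ∀ x, pr (s x) = x)
    (t : ⋀[ℂ]^b W ⊗[ℂ] ⋀[ℂ]^a X) :
    extSymbol h i pr hi ⟨extLift h i s t, extLift_mem h i s t⟩ = t := by
  let Φ : ⋀[ℂ]^b W ⊗[ℂ] ⋀[ℂ]^a X →ₗ[ℂ] ⋀[ℂ]^b W ⊗[ℂ] ⋀[ℂ]^a X :=
    extSymbol h i pr hi ∘ₗ (extLift h i s).codRestrict _ (extLift_mem h i s)
  have := ext_tensor_induction (LinearMap.eqLocus Φ LinearMap.id) fun u x => by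
    rw [LinearMap.mem_eqLocus]
    have h1 : Φ (ιMulti ℂ b u ⊗ₜ[ℂ] ιMulti ℂ a x) = extSymbol h i pr hi
        ⟨ιMulti ℂ j (catTuple h (i ∘ u) (s ∘ x)), ιMulti_cat_mem_extFilt i h u _⟩ :=
      congrArg (extSymbol h i pr hi) (Subtype.ext (extLift_tmul h i s u x))
    rw [h1, extSymbol_cat h i pr hi hpr]
    simp [Function.comp_def, hs]
  exact (this ▸ Submodule.mem_top : t ∈ LinearMap.eqLocus Φ LinearMap.id)

theorem extSymbol_eq_zero {b a j : ℕ} (h : b + a = j) (i : W →ₗ[ℂ] V) (pr : V →ₗ[ℂ] X)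
    (hi : Function.Injective i) (hex : ∀ v, pr v = 0 ↔ ∃ w, i w = v) (s : X →ₗ[ℂ] V)
    (hs : ∀ x, pr (s x) = x) (w : extFilt i j b) :
    extSymbol h i pr hi w = 0 ↔ (w : ⋀[ℂ]^j V) ∈ extFilt i j (b + 1) := by
  have hpr : ∀ w, pr (i w) = 0 := fun w => (hex _).2 ⟨w, rfl⟩
  let r := (i.exists_leftInverse_of_injective (LinearMap.ker_eq_bot.2 hi)).choose
  have hr : ∀ w, r (i w) = w := fun w => LinearMap.congr_fun
    (i.exists_leftInverse_of_injective (LinearMap.ker_eq_bot.2 hi)).choose_spec w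
  constructor
  · intro h0
    let Ψ : ⋀[ℂ]^j V →ₗ[ℂ] ⋀[ℂ]^j V ⧸ extFilt i j (b + 1) :=
      (extFilt i j (b + 1)).mkQ ∘ₗ (LinearMap.id - extLift h i s ∘ₗ coprodMap h r pr)
    have := extFilt_induction i h (LinearMap.ker Ψ) fun u v => by
      rw [LinearMap.mem_ker]
      simp only [Ψ, LinearMap.comp_apply, LinearMap.sub_apply, LinearMap.id_apply]
      rw [coprodMap_cat h i r pr hr hpr, extLift_tmul, Submodule.mkQ_apply,
        Submodule.Quotient.mk_eq_zero]
      refine ιMulti_cat_sub_mem i h u _ _ fun l => ?_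
      obtain ⟨w, hw⟩ := (hex (v l - s (pr (v l)))).1 (by simp [hs])
      exact ⟨w, hw⟩
    have h1 := this w.2
    have h2 : coprodMap h r pr w = 0 := h0
    rw [LinearMap.mem_ker] at h1
    simp only [Ψ, LinearMap.comp_apply, LinearMap.sub_apply, LinearMap.id_apply, h2, map_zero,
      sub_zero] at h1
    rwa [Submodule.mkQ_apply, Submodule.Quotient.mk_eq_zero] at h1
  · intro hw
    rcases Nat.eq_zero_or_pos a with rfl | ha
    · have : extFilt i j (b + 1) = ⊥ := by
        rw [extFilt, Submodule.span_eq_bot]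
        rintro _ ⟨hb, _⟩
        omega
      rw [this, Submodule.mem_bot] at hw
      have : w = 0 := Subtype.ext hw
      rw [this, map_zero]
    · have h' : (b + 1) + (a - 1) = j := by omega
      have := extFilt_induction i h' (LinearMap.ker (coprodMap h r pr)) fun u v => by
        have e : catTuple h' (i ∘ u) v = catTuple h (i ∘ fun m => u m.castSucc)
            (fun m : Fin a => if hm : (m : ℕ) = 0 then i (u (Fin.last b)) else
              v ⟨m - 1, by omega⟩) := by
          subst h
          funext m
          refine Fin.addCases (fun m => ?_) (fun m => ?_) m
          · simp only [catTuple, Function.comp_apply, Fin.append, Fin.cast]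
            have hm : (m : ℕ) < b + 1 := by omega
            simp [Fin.addCases]
            rfl
          · by_cases hm : (m : ℕ) = 0
            · simp [catTuple, Fin.append, Fin.addCases, hm]
              exact congrArg (fun t => i (u t)) (Fin.ext (by simp [hm]))
            · have hm1 : ¬ (b + (m : ℕ) < b + 1) := by omega
              simp [catTuple, Fin.append, Fin.addCases, hm, Fin.subNat]
              congr 2
              omega
        rw [LinearMap.mem_ker, e, coprodMap_cat h i r pr hr hpr]
        have h0 : ιMulti ℂ a (pr ∘ fun m : Fin a => if hm : (m : ℕ) = 0 then i (u (Fin.last b)) else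
              v ⟨m - 1, by omega⟩) = 0 :=
          AlternatingMap.map_coord_zero _ (⟨0, ha⟩ : Fin a) (by simp [hpr])
        rw [h0, TensorProduct.tmul_zero]
      exact this hw

/-- The comultiplication `⋀ᵃ⁺¹ X → X ⊗ ⋀ᵃ X`,
`x₀ ∧ … ∧ x_a ↦ 1/(a+1)! ∑ₖ (-1)ᵏ xₖ ⊗ (x₀ ∧ … x̂ₖ … ∧ x_a)`. -/
def extComul (X : Type*) [AddCommGroup X] [Module ℂ X] (a : ℕ) :
    ⋀[ℂ]^(a + 1) X →ₗ[ℂ] X ⊗[ℂ] ⋀[ℂ]^a X :=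
  (1 / (Nat.factorial (a + 1) : ℂ)) • alternatingMapLinearEquiv
    (AlternatingMap.alternatizeUncurryFin
      (alternatingMapLinearEquiv.symm.toLinearMap ∘ₗ TensorProduct.mk ℂ X (⋀[ℂ]^a X)))

/-- The wedge product `⋀ᵇ W ⊗ W → ⋀ᵇ⁺¹ W`. -/
def extSnoc (W : Type*) [AddCommGroup W] [Module ℂ W] (b : ℕ) :
    ⋀[ℂ]^b W ⊗[ℂ] W →ₗ[ℂ] ⋀[ℂ]^(b + 1) W :=
  TensorProduct.lift ((wedgeMul rfl).compl₂ (oneEquiv ℂ W).symm.toLinearMap)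

/-- Contraction with `θ : X → W`:
`⋀ᵇ W ⊗ ⋀ᵃ⁺¹ X → ⋀ᵇ W ⊗ X ⊗ ⋀ᵃ X → ⋀ᵇ W ⊗ W ⊗ ⋀ᵃ X → ⋀ᵇ⁺¹ W ⊗ ⋀ᵃ X`. -/
def extContr (W X : Type*) [AddCommGroup W] [Module ℂ W] [AddCommGroup X] [Module ℂ X] (b a : ℕ) :
    (X →ₗ[ℂ] W) →ₗ[ℂ] (⋀[ℂ]^b W ⊗[ℂ] ⋀[ℂ]^(a + 1) X) →ₗ[ℂ] (⋀[ℂ]^(b + 1) W ⊗[ℂ] ⋀[ℂ]^a X) where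
  toFun θ := (extSnoc W b).rTensor (⋀[ℂ]^a X) ∘ₗ
    (TensorProduct.assoc ℂ (⋀[ℂ]^b W) W (⋀[ℂ]^a X)).symm.toLinearMap ∘ₗ
    (θ.rTensor (⋀[ℂ]^a X) ∘ₗ extComul X a).lTensor (⋀[ℂ]^b W)
  map_add' θ θ' := by
    rw [LinearMap.rTensor_add, LinearMap.add_comp, LinearMap.lTensor_add, LinearMap.comp_add,
      LinearMap.comp_add]
  map_smul' r θ := by
    rw [LinearMap.rTensor_smul, LinearMap.smul_comp, LinearMap.lTensor_smul, LinearMap.comp_smul,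
      LinearMap.comp_smul]; rfl

theorem extContr_tmul (b a : ℕ) (θ : X →ₗ[ℂ] W) (u : Fin b → W) (x : Fin (a + 1) → X) :
    extContr W X b a θ (ιMulti ℂ b u ⊗ₜ[ℂ] ιMulti ℂ (a + 1) x) =
      ∑ k : Fin (a + 1), ((1 / (Nat.factorial (a + 1) : ℂ)) * (-1 : ℂ) ^ (k : ℕ)) •
        ιMulti ℂ (b + 1) (catTuple rfl u ![θ (x k)]) ⊗ₜ[ℂ] ιMulti ℂ a (k.removeNth x) := by
  have h1 : ∀ y : W, (oneEquiv ℂ W).symm y = ιMulti ℂ 1 ![y] := by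
    intro y
    rw [LinearEquiv.symm_apply_eq, oneEquiv_ιMulti]; rfl
  have h2 : extComul X a (ιMulti ℂ (a + 1) x) = (1 / (Nat.factorial (a + 1) : ℂ)) •
      ∑ k : Fin (a + 1), (-1 : ℂ) ^ (k : ℕ) • x k ⊗ₜ[ℂ] ιMulti ℂ a (k.removeNth x) := by
    have : ∀ (t : X ⊗[ℂ] ⋀[ℂ]^a X) (k : ℕ), (-1 : ℂ) ^ k • t = (-1 : ℤ) ^ k • t := fun t k => by
      rcases Nat.even_or_odd k with hk | hk <;> simp [hk.neg_one_pow]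
    simp [extComul, AlternatingMap.alternatizeUncurryFin_apply, this]
  have h3 : extContr W X b a θ (ιMulti ℂ b u ⊗ₜ[ℂ] ιMulti ℂ (a + 1) x) =
      (extSnoc W b).rTensor (⋀[ℂ]^a X)
        ((TensorProduct.assoc ℂ (⋀[ℂ]^b W) W (⋀[ℂ]^a X)).symm
          (TensorProduct.mk ℂ _ _ (ιMulti ℂ b u) (θ.rTensor (⋀[ℂ]^a X)
            (extComul X a (ιMulti ℂ (a + 1) x))))) := by simp [extContr]
  rw [h3, h2]
  simp only [map_smul, map_sum]
  rw [Finset.smul_sum]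
  refine Finset.sum_congr rfl fun k _ => ?_
  rw [mul_smul]
  congr 1
  congr 1
  simp [extSnoc, h1, wedgeMul_ιMulti]

end Exterior

/-! ### Exterior powers of sheaves -/

section ExteriorSheaves

open exteriorPower

variable {E : Type*} [NormedAddCommGroup E] [NormedSpace ℂ E] {H : Type*} [TopologicalSpace H]
  {I : ModelWithCorners ℂ E H} {Y : Type u} [TopologicalSpace Y] [ChartedSpace H Y]

/-- The `𝒪_Y`-submodule sheaf of the sheaf of all families in `fib` that is generated by the local
families `G`: its sections are locally finite sums `∑ fₖ gₖ`, `fₖ` holomorphic, `gₖ ∈ G`. -/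
@[reducible] def FibSheaf.gen (I : ModelWithCorners ℂ E H) {Y : Type u} [TopologicalSpace Y] [ChartedSpace H Y]
    (fib : Y → Type v) [∀ z, AddCommGroup (fib z)] [∀ z, Module ℂ (fib z)]
    (G : Y → Set (∀ z, fib z)) (hG : ∀ y, ∀ g ∈ G y, ∀ᶠ z in 𝓝 y, g ∈ G z) :
    FibSheaf.{u, v} I Y where
  fib := fib
  HolAt y :=
    { carrier := {s | ∃ t ∈ Submodule.span ℂ {w : ∀ z, fib z | ∃ f, HolFun I y f ∧
        ∃ g ∈ G y, w = fun z => f z • g z}, ∀ᶠ z in 𝓝 y, t z = s z}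
      zero_mem' := ⟨0, Submodule.zero_mem _, Eventually.of_forall fun _ => rfl⟩
      add_mem' := by
        rintro a b ⟨t, ht, hta⟩ ⟨t', ht', htb⟩
        exact ⟨t + t', Submodule.add_mem _ ht ht', by
          filter_upwards [hta, htb] with z h h'; simp [h, h']⟩
      smul_mem' := by
        rintro r a ⟨t, ht, hta⟩
        exact ⟨r • t, Submodule.smul_mem _ _ ht, by filter_upwards [hta] with z h; simp [h]⟩ }
  congr := by
    rintro y s s' hs ⟨t, ht, hts⟩
    exact ⟨t, ht, by filter_upwards [hs, hts] with z h h'; rw [h', h]⟩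
  spread := by
    rintro y s ⟨t, ht, hts⟩
    have : ∀ᶠ x in 𝓝 y, t ∈ Submodule.span ℂ {w : ∀ z, fib z | ∃ f, HolFun I x f ∧
        ∃ g ∈ G x, w = fun z => f z • g z} := by
      clear hts
      induction ht using Submodule.span_induction with
      | zero => exact Eventually.of_forall fun _ => Submodule.zero_mem _
      | add a b _ _ ha hb =>
        filter_upwards [ha, hb] with x h h' using Submodule.add_mem _ h h'
      | smul r a _ ha =>
        filter_upwards [ha] with x h using Submodule.smul_mem _ _ h
      | mem w hw =>
        obtain ⟨f, hf, g, hg, rfl⟩ := hw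
        filter_upwards [Filter.Eventually.eventually_nhds hf, hG y g hg] with x h h'
          using Submodule.subset_span ⟨f, h, g, h', rfl⟩
    filter_upwards [this, hts.eventually_nhds] with x h h' using ⟨t, h, h'⟩
  smul_hol := by
    rintro y f s hf ⟨t, ht, hts⟩
    refine ⟨fun z => f z • t z, ?_, by filter_upwards [hts] with z h; rw [h]⟩
    clear hts
    induction ht using Submodule.span_induction with
    | zero =>
      convert Submodule.zero_mem _ using 1
      funext z; simp
    | add a b _ _ ha hb =>
      have := Submodule.add_mem _ ha hb
      convert this using 1
      funext z; simp
    | smul r a _ ha =>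
      have := Submodule.smul_mem _ r ha
      convert this using 1
      funext z; exact smul_comm _ _ _
    | mem w hw =>
      obtain ⟨f', hf', g, hg, rfl⟩ := hw
      refine Submodule.subset_span ⟨fun z => f z * f' z, ?_, g, hg, by funext z; rw [mul_smul]⟩
      filter_upwards [hf, hf'] with z h h'
      exact ContMDiffAt.mul h h'

theorem FibSheaf.gen_mem {fib : Y → Type v} [∀ z, AddCommGroup (fib z)] [∀ z, Module ℂ (fib z)]
    {G : Y → Set (∀ z, fib z)} {hG : ∀ y, ∀ g ∈ G y, ∀ᶠ z in 𝓝 y, g ∈ G z} {y : Y}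
    {g : ∀ z, fib z} (hg : g ∈ G y) : g ∈ (FibSheaf.gen I fib G hG).HolAt y :=
  ⟨g, Submodule.subset_span ⟨fun _ => 1, Eventually.of_forall fun _ => contMDiffAt_const, g, hg,
    by simp⟩, Eventually.of_forall fun _ => rfl⟩

/-- A fibrewise linear map defined on a generated sheaf is a morphism if it is one on generators. -/
theorem FibSheaf.gen_hol {fib : Y → Type v} [∀ z, AddCommGroup (fib z)] [∀ z, Module ℂ (fib z)]
    {G : Y → Set (∀ z, fib z)} {hG : ∀ y, ∀ g ∈ G y, ∀ᶠ z in 𝓝 y, g ∈ G z}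
    (T : FibSheaf.{u, w} I Y) (φ : ∀ z, fib z →ₗ[ℂ] T.fib z) {y : Y}
    (hφ : ∀ g ∈ G y, (fun z => φ z (g z)) ∈ T.HolAt y) {s : ∀ z, fib z}
    (hs : s ∈ (FibSheaf.gen I fib G hG).HolAt y) : (fun z => φ z (s z)) ∈ T.HolAt y := by
  obtain ⟨t, ht, hts⟩ := hs
  refine T.congr (hts.mono fun z h => by rw [h]) (s := fun z => φ z (t z)) ?_
  clear hts
  induction ht using Submodule.span_induction with
  | zero =>
    convert (T.HolAt y).zero_mem using 1
    funext z; simp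
  | add a b _ _ ha hb =>
    have := (T.HolAt y).add_mem ha hb
    convert this using 1
    funext z; simp
  | smul r a _ ha =>
    have := (T.HolAt y).smul_mem r ha
    convert this using 1
    funext z; simp
  | mem w hw =>
    obtain ⟨f, hf, g, hg, rfl⟩ := hw
    have := T.smul_hol hf (hφ g hg)
    convert this using 1
    funext z; simp

theorem FibSheaf.sum_hol (T : FibSheaf.{u, w} I Y) {ι : Type*} [Fintype ι] {y : Y} (c : ι → ℂ)
    (g : ι → ∀ z, T.fib z) (hg : ∀ k, g k ∈ T.HolAt y) (t : ∀ z, T.fib z)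
    (ht : ∀ z, t z = ∑ k, c k • g k z) : t ∈ T.HolAt y := by
  have : t = ∑ k, c k • g k := by
    funext z
    rw [ht, Finset.sum_apply]
    rfl
  rw [this]
  exact Submodule.sum_mem _ fun k _ => Submodule.smul_mem _ _ (hg k)

/-- The subsheaf of the sections of `V` with values in the subspaces `P z`. -/
@[reducible] def FibSheaf.sub (V : FibSheaf.{u, v} I Y) (P : ∀ z, Submodule ℂ (V.fib z)) :
    FibSheaf.{u, v} I Y where
  fib z := P z
  HolAt y := (V.HolAt y).comap (LinearMap.pi fun z => (P z).subtype ∘ₗ LinearMap.proj z)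
  congr h hs := V.congr (h.mono fun z hz => by simp [hz]) hs
  spread hs := V.spread hs
  smul_hol hf hs := V.smul_hol hf hs

/-- The exterior power `⋀ʲ V` of a sheaf. -/
@[reducible] def FibSheaf.ext (V : FibSheaf.{u, v} I Y) (j : ℕ) : FibSheaf.{u, v} I Y :=
  FibSheaf.gen I (fun z => ⋀[ℂ]^j (V.fib z))
    (fun y => {g | ∃ t : Fin j → ∀ z, V.fib z, (∀ k, t k ∈ V.HolAt y) ∧
      g = fun z => ιMulti ℂ j fun k => t k z})
    (by
      rintro y g ⟨t, ht, rfl⟩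
      filter_upwards [eventually_all.2 fun k => V.spread (ht k)] with z hz using ⟨t, hz, rfl⟩)

/-- The sheaf `⋀ᵇ W ⊗ ⋀ᵃ X`. -/
@[reducible] def FibSheaf.extTensor (W X : FibSheaf.{u, v} I Y) (b a : ℕ) : FibSheaf.{u, v} I Y :=
  FibSheaf.gen I (fun z => ⋀[ℂ]^b (W.fib z) ⊗[ℂ] ⋀[ℂ]^a (X.fib z))
    (fun y => {g | ∃ (t : Fin b → ∀ z, W.fib z) (x : Fin a → ∀ z, X.fib z),
      (∀ k, t k ∈ W.HolAt y) ∧ (∀ k, x k ∈ X.HolAt y) ∧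
      g = fun z => ιMulti ℂ b (fun k => t k z) ⊗ₜ[ℂ] ιMulti ℂ a fun k => x k z})
    (by
      rintro y g ⟨t, x, ht, hx, rfl⟩
      filter_upwards [eventually_all.2 fun k => W.spread (ht k),
        eventually_all.2 fun k => X.spread (hx k)] with z hz hz' using ⟨t, x, hz, hz', rfl⟩)

theorem FibSheaf.ext_mem (V : FibSheaf.{u, v} I Y) {j : ℕ} {y : Y} {t : Fin j → ∀ z, V.fib z}
    (ht : ∀ k, t k ∈ V.HolAt y) : (fun z => ιMulti ℂ j fun k => t k z) ∈ (V.ext j).HolAt y :=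
  FibSheaf.gen_mem ⟨t, ht, rfl⟩

theorem FibSheaf.ext_hol (V : FibSheaf.{u, v} I Y) {j : ℕ} (T : FibSheaf.{u, w} I Y)
    (φ : ∀ z, ⋀[ℂ]^j (V.fib z) →ₗ[ℂ] T.fib z) {y : Y}
    (hφ : ∀ t : Fin j → ∀ z, V.fib z, (∀ k, t k ∈ V.HolAt y) →
      (fun z => φ z (ιMulti ℂ j fun k => t k z)) ∈ T.HolAt y) {s : ∀ z, ⋀[ℂ]^j (V.fib z)}
    (hs : s ∈ (V.ext j).HolAt y) : (fun z => φ z (s z)) ∈ T.HolAt y := by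
  refine FibSheaf.gen_hol T φ ?_ hs
  rintro _ ⟨t, ht, rfl⟩
  exact hφ t ht

theorem FibSheaf.extTensor_mem (W X : FibSheaf.{u, v} I Y) {b a : ℕ} {y : Y}
    {t : Fin b → ∀ z, W.fib z} {x : Fin a → ∀ z, X.fib z} (ht : ∀ k, t k ∈ W.HolAt y)
    (hx : ∀ k, x k ∈ X.HolAt y) :
    (fun z => ιMulti ℂ b (fun k => t k z) ⊗ₜ[ℂ] ιMulti ℂ a fun k => x k z) ∈
      (W.extTensor X b a).HolAt y :=
  FibSheaf.gen_mem ⟨t, x, ht, hx, rfl⟩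

theorem FibSheaf.extTensor_hol (W X : FibSheaf.{u, v} I Y) {b a : ℕ} (T : FibSheaf.{u, w} I Y)
    (φ : ∀ z, ⋀[ℂ]^b (W.fib z) ⊗[ℂ] ⋀[ℂ]^a (X.fib z) →ₗ[ℂ] T.fib z) {y : Y}
    (hφ : ∀ (t : Fin b → ∀ z, W.fib z) (x : Fin a → ∀ z, X.fib z), (∀ k, t k ∈ W.HolAt y) →
      (∀ k, x k ∈ X.HolAt y) →
      (fun z => φ z (ιMulti ℂ b (fun k => t k z) ⊗ₜ[ℂ] ιMulti ℂ a fun k => x k z)) ∈ T.HolAt y)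
    {s : ∀ z, ⋀[ℂ]^b (W.fib z) ⊗[ℂ] ⋀[ℂ]^a (X.fib z)}
    (hs : s ∈ (W.extTensor X b a).HolAt y) : (fun z => φ z (s z)) ∈ T.HolAt y := by
  refine FibSheaf.gen_hol T φ ?_ hs
  rintro _ ⟨t, x, ht, hx, rfl⟩
  exact hφ t x ht hx

/-- A pairing `P × S → T` induces a pairing `P × ℋom(R, S) → ℋom(R, T)`. -/
def FibPairing.post (R : FibSheaf.{u, v} I Y) {P : FibSheaf.{u, v} I Y} {S T : FibSheaf.{u, w} I Y}
    (m : FibPairing P S T) : FibPairing P (R.hom S) (R.hom T) where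
  app z := LinearMap.llcomp ℂ (R.fib z) (S.fib z) (T.fib z) ∘ₗ m.app z
  hol := by
    intro y θ (φ : ∀ z, R.fib z →ₗ[ℂ] S.fib z) hθ hφ
    filter_upwards [P.spread hθ, hφ] with x hx hx' s hs
    exact m.hol x _ _ hx (hx' s hs)

/-- The contraction `ℋom(X, W) × (⋀ᵇ W ⊗ ⋀ᵃ⁺¹ X) → ⋀ᵇ⁺¹ W ⊗ ⋀ᵃ X`. -/
def contrPairing (W X : FibSheaf.{u, v} I Y) (b a : ℕ) :
    FibPairing (X.hom W) (W.extTensor X b (a + 1)) (W.extTensor X (b + 1) a) where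
  app z := extContr (W.fib z) (X.fib z) b a
  hol := by
    intro x (θ : ∀ z, X.fib z →ₗ[ℂ] W.fib z) φ hθ hφ
    have hx := hθ.self_of_nhds
    refine FibSheaf.extTensor_hol W X (W.extTensor X (b + 1) a)
      (fun z => extContr (W.fib z) (X.fib z) b a (θ z)) (fun t ξ ht hξ => ?_) hφ
    refine FibSheaf.sum_hol (W.extTensor X (b + 1) a)
      (fun k : Fin (a + 1) => (1 / (Nat.factorial (a + 1) : ℂ)) * (-1 : ℂ) ^ (k : ℕ))
      (fun k z => ιMulti ℂ (b + 1) (catTuple rfl (fun l => t l z) ![θ z (ξ k z)]) ⊗ₜ[ℂ]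
        ιMulti ℂ a (k.removeNth fun l => ξ l z)) (fun k => ?_) _
      fun z => extContr_tmul b a (θ z) (fun k => t k z) fun k => ξ k z
    have := W.extTensor_mem X (b := b + 1) (a := a) (y := x)
      (t := catTuple rfl t ![fun z => θ z (ξ k z)]) (x := k.removeNth ξ) (fun l => ?_) fun l => hξ _
    · convert this using 1
      funext z
      congr 2
      funext l
      refine Fin.addCases (fun l => ?_) (fun l => ?_) l <;> simp [catTuple]
    · refine Fin.addCases (fun l => ?_) (fun l => ?_) l
      · simpa [catTuple] using ht l
      · simpa [catTuple] using hx _ (hξ k)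

/-- A short exact sequence `0 → W → V → X → 0` that splits locally. -/
structure FibSplit {W V X : FibSheaf.{u, v} I Y} (i : FibHom W V) (p : FibHom V X) : Prop extends
    FibExact i p where
  split : ∀ y, ∃ s : ∀ z, X.fib z →ₗ[ℂ] V.fib z, s ∈ (X.hom V).HolAt y ∧
    ∀ᶠ z in 𝓝 y, ∀ x, p.app z (s z x) = x

variable {W V X : FibSheaf.{u, v} I Y} {i : FibHom W V} {p : FibHom V X}

/-- `ℋom(R, -)` preserves locally split exact sequences. -/
theorem FibSplit.homExact (hS : FibSplit i p) (R : FibSheaf.{u, v} I Y) :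
    FibExact (i.post R) (p.post R) where
  inj z φ ψ h := LinearMap.ext fun r => hS.inj z (LinearMap.congr_fun h r)
  exact z (φ : R.fib z →ₗ[ℂ] V.fib z) := by
    constructor
    · intro h
      have : ∀ r, φ r ∈ LinearMap.range (i.app z) := fun r =>
        (hS.exact z _).1 (LinearMap.congr_fun h r)
      refine ⟨(LinearEquiv.ofInjective (i.app z) (hS.inj z)).symm.toLinearMap ∘ₗ
        φ.codRestrict _ this, LinearMap.ext fun r => ?_⟩
      change i.app z ((LinearEquiv.ofInjective (i.app z) (hS.inj z)).symm ⟨φ r, this r⟩) = φ r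
      exact congrArg Subtype.val
        ((LinearEquiv.ofInjective (i.app z) (hS.inj z)).apply_symm_apply ⟨φ r, this r⟩)
    · rintro ⟨ψ, rfl⟩
      exact LinearMap.ext fun r => (hS.exact z _).2 ⟨_, rfl⟩
  reflect y (φ : ∀ z, R.fib z →ₗ[ℂ] W.fib z) h := h.mono fun x hx s hs => hS.reflect x _ (hx s hs)
  lift y (φ : ∀ z, R.fib z →ₗ[ℂ] X.fib z) hφ := by
    obtain ⟨s, hs, hs'⟩ := hS.split y
    refine ⟨fun z => s z ∘ₗ φ z, ?_, ?_⟩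
    · filter_upwards [hs, hφ] with x hx hx' r hr using hx _ (hx' r hr)
    · filter_upwards [hs'] with z hz
      exact LinearMap.ext fun r => hz _

/-- The class `δ(1_X) ∈ H¹(Y, ℋom(X, W)) = Ext¹(X, W)` of a locally split extension
`0 → W → V → X → 0`. -/
def FibSplit.extClass [T2Space Y] [ParacompactSpace Y] (hS : FibSplit i p) : (X.hom W).Coh 1 :=
  (hS.homExact X).conn 0 ((X.hom X).cls0 (fun _ => LinearMap.id)
    fun _ => Eventually.of_forall fun _ _ hs => hs)

/-- The filtration `F_k` of `⋀ʲ V` by the products with at least `k` factors in `W`. -/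
@[reducible] def filtSheaf (i : FibHom W V) (j k : ℕ) : FibSheaf.{u, v} I Y :=
  (V.ext j).sub fun z => extFilt (i.app z) j k

/-- The inclusion `F_{k+1} ⊆ F_k`. -/
def filtIncl (i : FibHom W V) (j k : ℕ) : FibHom (filtSheaf i j (k + 1)) (filtSheaf i j k) where
  app z := Submodule.inclusion (extFilt_succ_le (i.app z) j k)
  hol _ _ hs := hs

/-- A local holomorphic retraction of `W → V`. -/
theorem FibSplit.retract (hS : FibSplit i p) (y : Y) :
    ∃ r : ∀ z, V.fib z →ₗ[ℂ] W.fib z, r ∈ (V.hom W).HolAt y ∧ ∀ᶠ z in 𝓝 y, ∀ w, r z (i.app z w) = w := by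
  obtain ⟨s, hs, hs'⟩ := hS.split y
  have hex : ∀ z, ∃ r : V.fib z →ₗ[ℂ] W.fib z, (∀ x, p.app z (s z x) = x) →
      ∀ v, i.app z (r v) = v - s z (p.app z v) := by
    intro z
    by_cases h : ∀ x, p.app z (s z x) = x
    · have hr : ∀ v, (LinearMap.id - s z ∘ₗ p.app z : V.fib z →ₗ[ℂ] V.fib z) v ∈
          LinearMap.range (i.app z) := fun v => (hS.exact z _).1 (by simp [h])
      refine ⟨(LinearEquiv.ofInjective (i.app z) (hS.inj z)).symm.toLinearMap ∘ₗ
        (LinearMap.id - s z ∘ₗ p.app z : V.fib z →ₗ[ℂ] V.fib z).codRestrict _ hr, fun _ v => ?_⟩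
      exact congrArg Subtype.val
        ((LinearEquiv.ofInjective (i.app z) (hS.inj z)).apply_symm_apply ⟨_, hr v⟩)
    · exact ⟨0, fun h' => absurd h' h⟩
  choose r hr using hex
  refine ⟨r, ?_, ?_⟩
  · filter_upwards [hs, hs'.eventually_nhds] with x hx hx' v hv
    refine hS.reflect x _ (V.congr ?_ ((V.HolAt x).sub_mem hv (hx _ (p.hol x v hv))))
    filter_upwards [hx'] with z hz
    rw [hr z hz]; rfl
  · filter_upwards [hs'] with z hz w
    refine hS.inj z ?_
    rw [hr z hz, (hS.exact z _).2 ⟨w, rfl⟩, map_zero, sub_zero]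

/-- The symbol map `F_b → ⋀ᵇ W ⊗ ⋀ᵃ X`, `a + b = j`, which identifies `F_b / F_{b+1}`. -/
def FibSplit.symbol (hS : FibSplit i p) {b a j : ℕ} (h : b + a = j) :
    FibHom (filtSheaf i j b) (W.extTensor X b a) where
  app z := extSymbol h (i.app z) (p.app z) (hS.inj z)
  hol := by
    intro y (s : ∀ z, extFilt (i.app z) j b) hs
    obtain ⟨r, hr, hr'⟩ := hS.retract y
    refine FibSheaf.congr (W.extTensor X b a) (s := fun z => coprodMap h (r z) (p.app z) (s z))
      (hr'.mono fun z hz => (extSymbol_eq h (i.app z) (r z) (p.app z) (hS.inj z) hz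
        (fun w => (hS.exact z _).2 ⟨w, rfl⟩) (s z)).symm) ?_
    have hs' : (fun z => (s z : ⋀[ℂ]^j (V.fib z))) ∈ (V.ext j).HolAt y := hs
    refine FibSheaf.ext_hol V (W.extTensor X b a) (fun z => coprodMap h (r z) (p.app z))
      (fun t ht => ?_) hs'
    refine FibSheaf.sum_hol (W.extTensor X b a) _ _ (fun σ => ?_) _
      fun z => coprodMap_ιMulti h (r z) (p.app z) fun k => t k z
    exact W.extTensor_mem X
      (t := fun l z => r z (t (finCongr h (finSumFinEquiv (σ.out (Sum.inl l)))) z))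
      (x := fun l z => p.app z (t (finCongr h (finSumFinEquiv (σ.out (Sum.inr l)))) z))
      (fun l => hr.self_of_nhds _ (ht _)) (fun l => p.hol y _ (ht _))

theorem FibSplit.symbol_split (hS : FibSplit i p) {b a j : ℕ} (h : b + a = j) (y : Y) :
    ∃ s : ∀ z, (W.extTensor X b a).fib z →ₗ[ℂ] (filtSheaf i j b).fib z,
      s ∈ ((W.extTensor X b a).hom (filtSheaf i j b)).HolAt y ∧
      ∀ᶠ z in 𝓝 y, ∀ x, (hS.symbol h).app z (s z x) = x := by
  obtain ⟨s, hs, hs'⟩ := hS.split y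
  refine ⟨fun z => (extLift h (i.app z) (s z)).codRestrict (extFilt (i.app z) j b)
    (extLift_mem h (i.app z) (s z)), ?_, ?_⟩
  · filter_upwards [hs] with x hx t ht
    change (fun z => extLift h (i.app z) (s z) (t z)) ∈ (V.ext j).HolAt x
    refine FibSheaf.extTensor_hol W X (V.ext j) (fun z => extLift h (i.app z) (s z))
      (fun u ξ hu hξ => ?_) ht
    have := V.ext_mem (j := j) (y := x) (t := catTuple h (fun l z => i.app z (u l z))
      fun l z => s z (ξ l z)) fun l => ?_
    · refine (V.ext j).congr (Eventually.of_forall fun z => ?_) this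
      refine Eq.trans ?_ (extLift_tmul h (i.app z) (s z) _ _).symm
      congr 1
      subst h
      funext l
      refine Fin.addCases (fun l => ?_) (fun l => ?_) l <;> simp [catTuple]
    · subst h
      refine Fin.addCases (fun l => ?_) (fun l => ?_) l
      · simpa [catTuple] using i.hol x _ (hu l)
      · simpa [catTuple] using hx _ (hξ l)
  · filter_upwards [hs'] with z hz t
    exact extSymbol_extLift h (i.app z) (p.app z) (hS.inj z)
      (fun w => (hS.exact z _).2 ⟨w, rfl⟩) (s z) hz t

/-- The sequence `0 → F_{b+1} → F_b → ⋀ᵇ W ⊗ ⋀ᵃ X → 0`, `a + b = j`, is exact and locally split. -/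
theorem FibSplit.filtSplit (hS : FibSplit i p) {b a j : ℕ} (h : b + a = j) :
    FibSplit (filtIncl i j b) (hS.symbol h) where
  inj z := Submodule.inclusion_injective (extFilt_succ_le (i.app z) j b)
  exact z (w : extFilt (i.app z) j b) := by
    obtain ⟨s, -, hs⟩ := hS.split z
    refine (extSymbol_eq_zero h (i.app z) (p.app z) (hS.inj z) (hS.exact z) (s z)
      hs.self_of_nhds w).trans ⟨fun hw => ⟨⟨w, hw⟩, rfl⟩, ?_⟩
    rintro ⟨w', rfl⟩
    exact w'.2
  reflect y s hs := hs
  lift y t ht := by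
    obtain ⟨s, hs, hs'⟩ := hS.symbol_split h y
    exact ⟨fun z => s z (t z), hs.self_of_nhds _ ht, hs'.mono fun z hz => hz _⟩
  split y := hS.symbol_split h y

end ExteriorSheaves

/-! ### Locally free sheaves, cotangent sheaves and `gt`-models -/

section LocallyFree

variable {E : Type*} [NormedAddCommGroup E] [NormedSpace ℂ E] {H : Type*} [TopologicalSpace H]
  {I : ModelWithCorners ℂ E H} {Y : Type u} [TopologicalSpace Y] [ChartedSpace H Y]
  {E' : Type*} [NormedAddCommGroup E'] [NormedSpace ℂ E'] {H' : Type*} [TopologicalSpace H']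
  {I' : ModelWithCorners ℂ E' H'} {B : Type u} [TopologicalSpace B] [ChartedSpace H' B]

/-- `S` is locally free of finite rank: near every point there are a frame `e` of the spaces `fib z`
and the corresponding coordinates `c`, and a family is a section of `S` if and only if its
coordinates are holomorphic. Thus `S` is the sheaf of holomorphic sections of a holomorphic vector
bundle with fibres `fib z`. -/
def FibSheaf.LocFree (S : FibSheaf.{u, v} I Y) : Prop :=
  ∀ y, ∃ (n : ℕ) (e : Fin n → ∀ z, S.fib z) (c : ∀ z, S.fib z →ₗ[ℂ] (Fin n → ℂ)),
    ∀ᶠ x in 𝓝 y, (∀ v, ∑ k, c x v k • e k x = v) ∧ (∀ r, c x (∑ k, r k • e k x) = r) ∧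
      ∀ s : ∀ z, S.fib z, s ∈ S.HolAt x ↔ ∀ k, HolFun I x fun z => c z (s z) k

theorem HolFun.comp {f : Y → B} (hf : ContMDiff I I' ω f) {y : Y} {g : B → ℂ}
    (hg : HolFun I' (f y) g) : HolFun I y (g ∘ f) := by
  filter_upwards [hf.continuous.continuousAt.eventually hg] with z hz
  exact ContMDiffAt.comp z hz (hf z)

/-- The inverse image `f^* S` of a sheaf of modules under a holomorphic map: its fibres are
`S.fib (f z)`, and it is generated by the pulled back sections of `S`. -/
@[reducible] def FibSheaf.pullback (f : Y → B) (hf : ContMDiff I I' ω f) (S : FibSheaf.{u, v} I' B) :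
    FibSheaf.{u, v} I Y :=
  FibSheaf.gen I (fun z => S.fib (f z)) (fun y => {g | ∃ s ∈ S.HolAt (f y), g = fun z => s (f z)})
    (by
      rintro y g ⟨s, hs, rfl⟩
      filter_upwards [hf.continuous.continuousAt.eventually (S.spread hs)] with z hz
        using ⟨s, hz, rfl⟩)

/-- The structure sheaf. -/
def structureSheaf (I : ModelWithCorners ℂ E H) (Y : Type u) [TopologicalSpace Y]
    [ChartedSpace H Y] : FibSheaf.{u, 0} I Y where
  fib _ := ℂ
  HolAt y :=
    { carrier := {f | HolFun I y f}
      zero_mem' := Eventually.of_forall fun _ => contMDiffAt_const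
      add_mem' := fun ha hb => by
        filter_upwards [ha, hb] with x h h' using ContMDiffAt.add h h'
      smul_mem' := fun r a ha => by
        filter_upwards [ha] with x h using ContMDiffAt.mul contMDiffAt_const h }
  congr h hs := by
    filter_upwards [h.eventually_nhds, hs] with x hx hx'
    exact hx'.congr_of_eventuallyEq (hx.mono fun z hz => hz.symm)
  spread hs := Eventually.eventually_nhds hs
  smul_hol hf hs := by
    filter_upwards [hf, hs] with x h h' using ContMDiffAt.mul h h'

theorem HolFun.const (y : Y) (r : ℂ) : HolFun I y fun _ => r :=
  Eventually.of_forall fun _ => contMDiffAt_const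

theorem HolFun.congr {y : Y} {f g : Y → ℂ} (hf : HolFun I y f) (h : ∀ᶠ z in 𝓝 y, f z = g z) :
    HolFun I y g := (structureSheaf I Y).congr h hf

theorem FibSheaf.LocFree.frame {S : FibSheaf.{u, v} I Y} (hS : S.LocFree) (y : Y) :
    ∃ (n : ℕ) (e : Fin n → ∀ z, S.fib z) (c : ∀ z, S.fib z →ₗ[ℂ] (Fin n → ℂ)),
    ∀ᶠ x in 𝓝 y, (∀ v, ∑ k, c x v k • e k x = v) ∧ (∀ r, c x (∑ k, r k • e k x) = r) ∧
      (∀ s : ∀ z, S.fib z, s ∈ S.HolAt x ↔ ∀ k, HolFun I x fun z => c z (s z) k) ∧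
      ∀ k, e k ∈ S.HolAt x := by
  obtain ⟨n, e, c, h⟩ := hS y
  refine ⟨n, e, c, ?_⟩
  filter_upwards [h.eventually_nhds] with x hx
  have h0 := hx.self_of_nhds
  refine ⟨h0.1, h0.2.1, h0.2.2, fun k => (h0.2.2 _).2 fun l =>
    (HolFun.const x ((Pi.single k 1 : Fin n → ℂ) l)).congr ?_⟩
  filter_upwards [hx] with z hz
  have := congrFun (hz.2.1 (Pi.single k 1)) l
  rw [← this]
  rw [Finset.sum_eq_single k] <;> simp +contextual

theorem FibSheaf.pullback_hol {f : Y → B} {hf : ContMDiff I I' ω f} {S : FibSheaf.{u, v} I' B}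
    (T : FibSheaf.{u, w} I Y) (φ : ∀ z, S.fib (f z) →ₗ[ℂ] T.fib z) {y : Y}
    (hφ : ∀ s ∈ S.HolAt (f y), (fun z => φ z (s (f z))) ∈ T.HolAt y) {s : ∀ z, S.fib (f z)}
    (hs : s ∈ (S.pullback f hf).HolAt y) : (fun z => φ z (s z)) ∈ T.HolAt y := by
  refine FibSheaf.gen_hol T φ ?_ hs
  rintro _ ⟨s, hs, rfl⟩
  exact hφ s hs

theorem FibSheaf.LocFree.pullback {S : FibSheaf.{u, v} I' B} (hS : S.LocFree) (f : Y → B)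
    (hf : ContMDiff I I' ω f) : (S.pullback f hf).LocFree := by
  intro y
  obtain ⟨n, e, c, h⟩ := hS.frame (f y)
  refine ⟨n, fun k z => e k (f z), fun z => c (f z), ?_⟩
  filter_upwards [(hf.continuous.continuousAt.eventually h).eventually_nhds] with x hx
  refine ⟨hx.self_of_nhds.1, hx.self_of_nhds.2.1, fun s => ⟨fun hs k => ?_, fun hs => ?_⟩⟩
  · let φ : ∀ z, S.fib (f z) →ₗ[ℂ] ℂ := fun z => LinearMap.proj k ∘ₗ c (f z)
    exact FibSheaf.pullback_hol (structureSheaf I Y) φ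
      (fun s hs => HolFun.comp hf ((hx.self_of_nhds.2.2.1 s).1 hs k)) hs
  · refine (S.pullback f hf).congr (s := fun z => ∑ k, c (f z) (s z) k • e k (f z)) ?_ ?_
    · filter_upwards [hx] with z hz using hz.1 _
    · have : (fun z => ∑ k, c (f z) (s z) k • e k (f z)) =
          ∑ k, fun z => c (f z) (s z) k • e k (f z) := by
        funext z; rw [Finset.sum_apply]
      rw [this]
      exact Submodule.sum_mem _ fun k _ => (S.pullback f hf).smul_hol (hs k)
        (FibSheaf.gen_mem ⟨e k, hx.self_of_nhds.2.2.2 k, rfl⟩)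

/-- The holomorphic cotangent sheaf `Ω¹`, generated by the differentials of holomorphic functions. -/
def cotangentSheaf (I : ModelWithCorners ℂ E H) (Y : Type u) [TopologicalSpace Y]
    [ChartedSpace H Y] : FibSheaf I Y :=
  FibSheaf.gen I (fun z => TangentSpace I z →L[ℂ] ℂ)
    (fun y => {g | ∃ f : Y → ℂ, HolFun I y f ∧ g = fun z => mfderiv I 𝓘(ℂ, ℂ) f z})
    (by
      rintro y g ⟨f, hf, rfl⟩
      filter_upwards [Eventually.eventually_nhds hf] with z hz using ⟨f, hz, rfl⟩)

variable {W V X : FibSheaf.{u, v} I Y}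

/-- `0 → W → V → X → 0` is a short exact sequence of sheaves (exactness on all stalks). -/
structure ShortExactSheaves (i : FibHom W V) (p : FibHom V X) : Prop where
  injective : ∀ y, ∀ s ∈ W.HolAt y, (∀ᶠ z in 𝓝 y, i.app z (s z) = 0) → ∀ᶠ z in 𝓝 y, s z = 0
  exact : ∀ y, ∀ s ∈ V.HolAt y, (∀ᶠ z in 𝓝 y, p.app z (s z) = 0) ↔
    ∃ t ∈ W.HolAt y, ∀ᶠ z in 𝓝 y, i.app z (t z) = s z
  surjective : ∀ y, ∀ s ∈ X.HolAt y, ∃ t ∈ V.HolAt y, ∀ᶠ z in 𝓝 y, p.app z (t z) = s z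

theorem FibSheaf.sum_smul_hol (T : FibSheaf.{u, w} I Y) {n : ℕ} {y : Y} {f : Fin n → Y → ℂ}
    {g : Fin n → ∀ z, T.fib z} (hf : ∀ k, HolFun I y (f k)) (hg : ∀ k, g k ∈ T.HolAt y) :
    (fun z => ∑ k, f k z • g k z) ∈ T.HolAt y := by
  have : (fun z => ∑ k, f k z • g k z) = ∑ k, fun z => f k z • g k z := by
    funext z; rw [Finset.sum_apply]
  rw [this]
  exact Submodule.sum_mem _ fun k _ => T.smul_hol (hf k) (hg k)

/-- The map out of a locally free sheaf with given values on a frame. -/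
def frameMap (T : FibSheaf.{u, w} I Y) (S : FibSheaf.{u, v} I Y) {n : ℕ}
    (c : ∀ z, S.fib z →ₗ[ℂ] (Fin n → ℂ)) (t : Fin n → ∀ z, T.fib z) (z : Y) :
    S.fib z →ₗ[ℂ] T.fib z :=
  ∑ k, (LinearMap.proj k ∘ₗ c z).smulRight (t k z)

theorem frameMap_apply (T : FibSheaf.{u, w} I Y) (S : FibSheaf.{u, v} I Y) {n : ℕ}
    (c : ∀ z, S.fib z →ₗ[ℂ] (Fin n → ℂ)) (t : Fin n → ∀ z, T.fib z) (z : Y) (v : S.fib z) :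
    frameMap T S c t z v = ∑ k, c z v k • t k z := by
  simp [frameMap, LinearMap.sum_apply]

/-- A short exact sequence of locally free sheaves splits locally. -/
theorem ShortExactSheaves.fibSplit {i : FibHom W V} {p : FibHom V X} (hE : ShortExactSheaves i p)
    (hW : W.LocFree) (hV : V.LocFree) (hX : X.LocFree) : FibSplit i p := by
  have key : ∀ y, ∃ (s : ∀ z, X.fib z →ₗ[ℂ] V.fib z) (r : ∀ z, V.fib z →ₗ[ℂ] W.fib z),
      s ∈ (X.hom V).HolAt y ∧ r ∈ (V.hom W).HolAt y ∧
      ∀ᶠ z in 𝓝 y, (∀ x, p.app z (s z x) = x) ∧ (∀ w, r z (i.app z w) = w) ∧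
        (∀ w, p.app z (i.app z w) = 0) ∧ ∀ v, i.app z (r z v) = v - s z (p.app z v) := by
    intro y
    obtain ⟨n, e, c, h⟩ := hX.frame y
    choose t ht hpt using fun k => hE.surjective y (e k) (h.self_of_nhds.2.2.2 k)
    let s := frameMap V X c t
    have hs : s ∈ (X.hom V).HolAt y := by
      filter_upwards [h, eventually_all.2 fun k => V.spread (ht k)] with x hx hx' ξ hξ
      simp only [s, frameMap_apply]
      exact V.sum_smul_hol ((hx.2.2.1 ξ).1 hξ) hx'
    have hps : ∀ᶠ z in 𝓝 y, ∀ x, p.app z (s z x) = x := by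
      filter_upwards [h, eventually_all.2 hpt] with z hz hz' x
      simp only [s, frameMap_apply, map_sum, map_smul, hz']
      exact hz.1 x
    obtain ⟨nW, eW, cW, hWf⟩ := hW.frame y
    have hpi : ∀ᶠ z in 𝓝 y, ∀ w, p.app z (i.app z w) = 0 := by
      have : ∀ k, ∀ᶠ z in 𝓝 y, p.app z (i.app z (eW k z)) = 0 := fun k =>
        (hE.exact y _ (i.hol y _ (hWf.self_of_nhds.2.2.2 k))).2
          ⟨eW k, hWf.self_of_nhds.2.2.2 k, Eventually.of_forall fun _ => rfl⟩
      filter_upwards [hWf, eventually_all.2 this] with z hz hz' w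
      rw [← hz.1 w]
      simp [hz']
    obtain ⟨m, eV, cV, hVf⟩ := hV.frame y
    have hg : ∀ k, ∃ t ∈ W.HolAt y, ∀ᶠ z in 𝓝 y,
        i.app z (t z) = eV k z - s z (p.app z (eV k z)) := fun k => by
      have hk := hVf.self_of_nhds.2.2.2 k
      refine (hE.exact y (fun z => eV k z - s z (p.app z (eV k z)))
        ((V.HolAt y).sub_mem hk (hs.self_of_nhds _ (p.hol y _ hk)))).1 ?_
      filter_upwards [hps] with z hz
      rw [map_sub, hz, sub_self]
    choose g hgW hgi using hg
    let r := frameMap W V cV g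
    have hr : r ∈ (V.hom W).HolAt y := by
      filter_upwards [hVf, eventually_all.2 fun k => W.spread (hgW k)] with x hx hx' ξ hξ
      simp only [r, frameMap_apply]
      exact W.sum_smul_hol ((hx.2.2.1 ξ).1 hξ) hx'
    have hir : ∀ᶠ z in 𝓝 y, ∀ v, i.app z (r z v) = v - s z (p.app z v) := by
      filter_upwards [hVf, eventually_all.2 hgi] with z hz hz' v
      simp only [r, frameMap_apply, map_sum, map_smul, hz', smul_sub, Finset.sum_sub_distrib]
      rw [hz.1 v]
      congr 1
      conv_rhs => rw [← hz.1 v]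
      simp
    have hri : ∀ᶠ z in 𝓝 y, ∀ w, r z (i.app z w) = w := by
      have : ∀ k, ∀ᶠ z in 𝓝 y, r z (i.app z (eW k z)) - eW k z = 0 := fun k => by
        have hk := hWf.self_of_nhds.2.2.2 k
        refine hE.injective y (fun z => r z (i.app z (eW k z)) - eW k z)
          ((W.HolAt y).sub_mem (hr.self_of_nhds _ (i.hol y _ hk)) hk) ?_
        filter_upwards [hir, hpi] with z hz hz'
        rw [map_sub, hz, hz', map_zero, sub_zero, sub_self]
      filter_upwards [hWf, eventually_all.2 this] with z hz hz' w
      conv_rhs => rw [← hz.1 w]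
      conv_lhs => rw [← hz.1 w]
      simp only [map_sum, map_smul]
      exact Finset.sum_congr rfl fun k _ => by rw [sub_eq_zero.1 (hz' k)]
    refine ⟨s, r, hs, hr, ?_⟩
    filter_upwards [hps, hri, hpi, hir] with z h1 h2 h3 h4 using ⟨h1, h2, h3, h4⟩
  refine ⟨⟨fun z w w' hw => ?_, fun z v => ⟨fun hv => ?_, ?_⟩, fun y s hs => ?_, fun y t ht => ?_⟩,
    fun y => ?_⟩
  · obtain ⟨s, r, -, -, h⟩ := key z
    have h2 := h.self_of_nhds.2.1
    rw [← h2 w, hw, h2]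
  · obtain ⟨s, r, -, -, h⟩ := key z
    exact ⟨r z v, by rw [h.self_of_nhds.2.2.2, hv, map_zero, sub_zero]⟩
  · rintro ⟨w, rfl⟩
    obtain ⟨s, r, -, -, h⟩ := key z
    exact h.self_of_nhds.2.2.1 w
  · obtain ⟨s', r, -, hr, h⟩ := key y
    exact W.congr (h.mono fun z hz => hz.2.1 _) (hr.self_of_nhds _ hs)
  · obtain ⟨s, r, hs, -, h⟩ := key y
    exact ⟨_, hs.self_of_nhds _ ht, h.mono fun z hz => hz.1 _⟩
  · obtain ⟨s, r, hs, -, h⟩ := key y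
    exact ⟨s, hs, h.mono fun z hz => hz.1⟩

end LocallyFree

section Model

variable {EX EB : Type u} [NormedAddCommGroup EX] [NormedSpace ℂ EX] [FiniteDimensional ℂ EX]
  [NormedAddCommGroup EB] [NormedSpace ℂ EB] [FiniteDimensional ℂ EB]
  {X B : Type u} [TopologicalSpace X] [ChartedSpace EX X] [IsManifold 𝓘(ℂ, EX) ω X]
  [T2Space X] [SecondCountableTopology X]
  [TopologicalSpace B] [ChartedSpace EB B] [IsManifold 𝓘(ℂ, EB) ω B]
  [T2Space B] [SecondCountableTopology B]

/-- Products of complex manifolds are paracompact. -/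
theorem paracompact_prod (EX EB : Type u) [NormedAddCommGroup EX] [NormedSpace ℂ EX]
    [FiniteDimensional ℂ EX] [NormedAddCommGroup EB] [NormedSpace ℂ EB] [FiniteDimensional ℂ EB]
    (X B : Type u) [TopologicalSpace X] [ChartedSpace EX X] [T2Space X] [SecondCountableTopology X]
    [TopologicalSpace B] [ChartedSpace EB B] [T2Space B] [SecondCountableTopology B] :
    ParacompactSpace (X × B) := by
  have : LocallyCompactSpace X := Manifold.locallyCompact_of_finiteDimensional 𝓘(ℂ, EX)
  have : LocallyCompactSpace B := Manifold.locallyCompact_of_finiteDimensional 𝓘(ℂ, EB)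
  infer_instance

variable (EX EB X B) in
/-- A `gt`-model over `(B, T^*_{B,-})` with fibre `(X, T^*_{X,-})`: complex manifolds `X` and `B`,
locally free sheaves `TX = T^*_{X,-}` on `X`, `TB = T^*_{B,-}` on `B` and `TY = T^*_{Y,-}` on
`Y = X × B`, and a short exact sequence `0 → p_B^* TB → TY → p_X^* TX → 0`. -/
structure GTModel where
  TX : FibSheaf.{u, u} 𝓘(ℂ, EX) X
  TB : FibSheaf.{u, u} 𝓘(ℂ, EB) B
  TY : FibSheaf.{u, u} (𝓘(ℂ, EX).prod 𝓘(ℂ, EB)) (X × B)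
  freeX : TX.LocFree
  freeB : TB.LocFree
  freeY : TY.LocFree
  incl : FibHom (TB.pullback Prod.snd contMDiff_snd) TY
  proj : FibHom TY (TX.pullback Prod.fst contMDiff_fst)
  exact : ShortExactSheaves incl proj

namespace GTModel

variable (M : GTModel EX EB X B)

/-- `p_B^* T^*_{B,-}`. -/
@[reducible] def pTB : FibSheaf.{u, u} (𝓘(ℂ, EX).prod 𝓘(ℂ, EB)) (X × B) :=
  M.TB.pullback Prod.snd contMDiff_snd

/-- `p_X^* T^*_{X,-}`. -/
@[reducible] def pTX : FibSheaf.{u, u} (𝓘(ℂ, EX).prod 𝓘(ℂ, EB)) (X × B) :=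
  M.TX.pullback Prod.fst contMDiff_fst

theorem fibSplit : FibSplit M.incl M.proj :=
  M.exact.fibSplit (M.freeB.pullback _ _) M.freeY (M.freeX.pullback _ _)

/-- `T^*_{Y,(±)^j}`: the holomorphic cotangent sheaf of `Y` for even `j`, and `T^*_{Y,-}` for
odd `j`. -/
def Tpm (j : ℕ) : FibSheaf.{u, u} (𝓘(ℂ, EX).prod 𝓘(ℂ, EB)) (X × B) :=
  if Even j then cotangentSheaf (𝓘(ℂ, EX).prod 𝓘(ℂ, EB)) (X × B) else M.TY

/-- The step `F_k` of the filtration of `⋀ʲ T^*_{Y,-}`. -/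
def F (j k : ℕ) : FibSheaf.{u, u} (𝓘(ℂ, EX).prod 𝓘(ℂ, EB)) (X × B) := filtSheaf M.incl j k

/-- The graded piece `⋀ᵇ T^*_{B,-} ⊠ ⋀ᵃ T^*_{X,-}`. -/
def gr (a b : ℕ) : FibSheaf.{u, u} (𝓘(ℂ, EX).prod 𝓘(ℂ, EB)) (X × B) :=
  M.pTB.extTensor M.pTX b a

/-- `H^{a,b}_p(Y, T^*_{Y,-}) = Hᵖ(Y, ℋom(T^*_{Y,(±)^j}, ⋀ᵇ T^*_{B,-} ⊠ ⋀ᵃ T^*_{X,-}))`, used for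
`a + b = j`. -/
abbrev H (j a b p : ℕ) : Type u := ((M.Tpm j).hom (M.gr a b)).Coh p

/-- The quotient map `F_b → F_b / F_{b+1} = ⋀ᵇ T^*_{B,-} ⊠ ⋀ᵃ T^*_{X,-}`, `a + b = j`. -/
def symbol {j a b : ℕ} (h : a + b = j) : FibHom (M.F j b) (M.gr a b) :=
  M.fibSplit.symbol ((add_comm b a).trans h)

/-- Exactness of `0 → F_{b+1} → F_b → ⋀ᵇ T^*_{B,-} ⊠ ⋀ᵃ T^*_{X,-} → 0`. -/
theorem filt_split {j a b : ℕ} (h : a + b = j) :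
    FibSplit (W := M.F j (b + 1)) (filtIncl M.incl j b) (M.symbol h) :=
  M.fibSplit.filtSplit ((add_comm b a).trans h)

/-- The differential `∂^{a+1,b}_p : H^{a+1,b}_p → H^{a,b+1}_{p+1}` of the secondary obstruction
complex: the connecting map `H^{a+1,b}_p → Hᵖ⁺¹(Y, ℋom(T^*_{Y,(±)^j}, F_{b+1}))` followed by the
projection `F_{b+1} → F_{b+1} / F_{b+2}`. -/
def obstructionMap {j a b : ℕ} (h : a + 1 + b = j) (p : ℕ) :
    M.H j (a + 1) b p →ₗ[ℂ] M.H j a (b + 1) (p + 1) :=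
  haveI := paracompact_prod EX EB X B
  ((M.symbol (by omega : a + (b + 1) = j)).post (M.Tpm j)).cohMap (p + 1) ∘ₗ
    ((M.filt_split h).homExact (M.Tpm j)).conn p

/-- The model class `Θ(T^*_{Y,-}) ∈ H¹(Y, ℋom(p_X^* T^*_{X,-}, p_B^* T^*_{B,-}))
= Ext¹(p_X^* T^*_{X,-}, p_B^* T^*_{B,-})`: the image of the identity of `p_X^* T^*_{X,-}` under the
connecting map of `ℋom(p_X^* T^*_{X,-}, -)` applied to the exact sequence of the model. -/
def modelClass : (M.pTX.hom M.pTB).Coh 1 :=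
  haveI := paracompact_prod EX EB X B
  M.fibSplit.extClass

/-- The model class map `(Θ(T^*_{Y,-}), -)_*^{a+1,b} : H^{a+1,b}_p → H^{a,b+1}_{p+1}`, `a+1+b = j`:
the cup product with the model class, composed with the map of coefficients
`⋀ᵇ TB ⊗ ⋀ᵃ⁺¹ TX → ⋀ᵇ TB ⊗ TX ⊗ ⋀ᵃ TX → ⋀ᵇ TB ⊗ TB ⊗ ⋀ᵃ TX → ⋀ᵇ⁺¹ TB ⊗ ⋀ᵃ TX`. -/
def modelClassMap (j a b p : ℕ) : M.H j (a + 1) b p →ₗ[ℂ] M.H j a (b + 1) (p + 1) :=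
  ((contrPairing M.pTB M.pTX b a).post (M.Tpm j)).cup p M.modelClass

end GTModel

end Model

end

/-! In degree `a = 1` the two maps are equal, and the inclusion of images follows at once. Write `0
→ W → V → X → 0` for the exact sequence of the model, `i` for its first map, and let `R` be the
sheaf from which homomorphisms are taken. Nothing about `R` matters, so the parity of `j` plays no
role.

The sequence splits locally, and any choice of splittings `s_y` of `V → X` on a cover represents the
extension class: the difference `s_{y'} - s_y` is `i ∘ θ_{yy'}`, where `θ` is a cocycle for `Θ`. The
same splittings compute the connecting map of the filtration. A cocycle `c` with values in `ℋom(R,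
⋀ᵇ W ⊗ X)` lifts to `F_b` as `n_σ = L(s_{σ 0}) ∘ c_σ`, where `L(s)` sends `u ⊗ x` to `i u₁ ∧ … ∧ i
u_b ∧ s x`. Only one factor is lifted, so `L` is linear in `s` (`extLiftOne`); with two or more
lifted factors it would only be the diagonal of a multilinear expression. Linearity makes `n` a
product of a `0`-cochain with a cocycle, and the Leibniz rule `cechD_cup0` gives `(δn)_σ = L(s_{σ 1}
- s_{σ 0}) ∘ c_{tail σ} = L(i ∘ θ_{σ 0, σ 1}) ∘ c_{tail σ}`.

It remains to read off the symbol of this element in `⋀ᵇ⁺¹ W`. All its factors come from `W`, so the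
symbol is `u₁ ∧ … ∧ u_b ∧ θ x`, which is the contraction of `θ` with `u ⊗ x`
(`coprodMap_extLift_comp`, `extSymbol_eq_extContr`). The normalising factor of the contraction is
`1/1! = 1`, so not even a scalar separates the two maps. The equality is thus one of cocycles on a
cover, proved in `FibSplit.symbol_conn_eq_cup`. Two facts pass to classes: any lift computes the
connecting map (`FibExact.conn_cls_of_lift`), and the extension class is given by differences of
splittings (`FibSplit.exists_splittings`). -/

/-! ### Linear algebra on one fibre: lifting a single factor, and the symbol of the result. -/

section Exterior

open exteriorPower

variable {V W X : Type*} [AddCommGroup V] [Module ℂ V] [AddCommGroup W] [Module ℂ W]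
  [AddCommGroup X] [Module ℂ X]

/-- If only one factor is lifted, then `extLift` is linear in the lift. -/
noncomputable def extLiftOne {b j : ℕ} (h : b + 1 = j) (i : W →ₗ[ℂ] V) :
    (X →ₗ[ℂ] V) →ₗ[ℂ] ⋀[ℂ]^b W ⊗[ℂ] ⋀[ℂ]^1 X →ₗ[ℂ] ⋀[ℂ]^j V where
  toFun s := extLift h i s
  map_add' s s' := by
    have := ext_tensor_induction (b := b) (a := 1)
      (LinearMap.eqLocus (extLift h i (s + s')) (extLift h i s + extLift h i s')) fun u x => by
        rw [LinearMap.mem_eqLocus, LinearMap.add_apply, extLift_tmul, extLift_tmul, extLift_tmul,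
          ← wedgeMul_ιMulti, ← wedgeMul_ιMulti, ← wedgeMul_ιMulti, ← map_add]
        congr 1
        -- The common factor from `W` has been cancelled, and what remains is a product of length
        -- one. This is where having a single lifted factor is used: `⋀¹ V` is `V`, so additivity in
        -- `s` is pointwise addition of maps.
        refine (oneEquiv ℂ V).injective ?_
        rw [map_add, oneEquiv_ιMulti, oneEquiv_ιMulti, oneEquiv_ιMulti]
        rfl
    exact LinearMap.ext fun t => (this ▸ Submodule.mem_top : t ∈ LinearMap.eqLocus _ _)
  map_smul' r s := by
    have := ext_tensor_induction (b := b) (a := 1)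
      (LinearMap.eqLocus (extLift h i (r • s)) (r • extLift h i s)) fun u x => by
        rw [LinearMap.mem_eqLocus, LinearMap.smul_apply, extLift_tmul, extLift_tmul,
          ← wedgeMul_ιMulti, ← wedgeMul_ιMulti, ← map_smul]
        congr 1
        refine (oneEquiv ℂ V).injective ?_
        rw [map_smul, oneEquiv_ιMulti, oneEquiv_ιMulti]
        rfl
    exact LinearMap.ext fun t => (this ▸ Submodule.mem_top : t ∈ LinearMap.eqLocus _ _)

/-- A lift along `i ∘ θ` puts the last factor into `W` too, so the product has `b + 1` factors from
`W` and none left over. The retraction `r` recovers these factors, with the new one `θ x` in last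
position, exactly where the contraction places it; hence there is no sign. `h` and `h'` are two ways
of cutting the same `j` factors, as `b + 1` and as `(b + 1) + 0`. -/
theorem coprodMap_extLift_comp {b j : ℕ} (h : b + 1 = j) (h' : b + 1 + 0 = j) (i : W →ₗ[ℂ] V)
    (r : V →ₗ[ℂ] W) (pr : V →ₗ[ℂ] X) (hr : ∀ w, r (i w) = w) (hpr : ∀ w, pr (i w) = 0)
    (θ : X →ₗ[ℂ] W) (t : ⋀[ℂ]^b W ⊗[ℂ] ⋀[ℂ]^1 X) :
    coprodMap h' r pr (extLift h i (i ∘ₗ θ) t) = extContr W X b 0 θ t := by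
  have := ext_tensor_induction (b := b) (a := 1)
    (LinearMap.eqLocus (coprodMap h' r pr ∘ₗ extLift h i (i ∘ₗ θ)) (extContr W X b 0 θ))
    fun u x => by
      -- Regroup the tuple: the entry `i (θ x)` moves from the second block to the end of the first,
      -- leaving an empty second block. In this form `coprodMap_cat` applies with `b + 1` entries
      -- from `W`.
      have e : catTuple h (i ∘ u) ((i ∘ₗ θ) ∘ x) =
          catTuple h' (i ∘ catTuple rfl u ![θ (x 0)]) (Fin.elim0 : Fin 0 → V) := by
        subst h
        funext m
        refine Fin.addCases (fun m => ?_) (fun m => ?_) m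
        · simp [catTuple, Fin.append, Fin.addCases]
          rfl
        · obtain rfl : m = 0 := Subsingleton.elim _ _
          simp [catTuple, Fin.append, Fin.addCases]
      rw [LinearMap.mem_eqLocus, LinearMap.comp_apply, extLift_tmul, e,
        coprodMap_cat h' i r pr hr hpr, extContr_tmul]
      simp only [Fin.sum_univ_succ, Finset.univ_eq_empty, Finset.sum_empty]
      -- The sum has the single term `k = 0`, with coefficient `1/1! · (-1)⁰ = 1`. The tuples left
      -- in the `⋀⁰ X` factor are both empty, hence equal.
      simp [Subsingleton.elim (pr ∘ (Fin.elim0 : Fin 0 → V)) (Fin.tail x)]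
  exact (this ▸ Submodule.mem_top : t ∈ LinearMap.eqLocus _ _)

/-- The symbol is defined through a chosen retraction but agrees with the formula for any
retraction, which reduces the claim to the previous computation. The hypothesis `hw` is an equation
in `⋀ʲ V` because the connecting cocycle is known only through its image there; that it lies in the
smaller step `F_{b+1}` is carried by the type of `w`. -/
theorem extSymbol_eq_extContr {b j : ℕ} (h : b + 1 = j) (h' : b + 1 + 0 = j) (i : W →ₗ[ℂ] V)
    (pr : V →ₗ[ℂ] X) (hi : Function.Injective i) (hpr : ∀ w, pr (i w) = 0) (θ : X →ₗ[ℂ] W)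
    (t : ⋀[ℂ]^b W ⊗[ℂ] ⋀[ℂ]^1 X) (w : extFilt i j (b + 1))
    (hw : (w : ⋀[ℂ]^j V) = extLift h i (i ∘ₗ θ) t) :
    extSymbol h' i pr hi w = extContr W X b 0 θ t := by
  obtain ⟨r, hr⟩ := i.exists_leftInverse_of_injective (LinearMap.ker_eq_bot.2 hi)
  have hr' : ∀ w, r (i w) = w := fun w => LinearMap.congr_fun hr w
  rw [extSymbol_eq h' i r pr hi hr' hpr, hw, coprodMap_extLift_comp h h' i r pr hr' hpr]

end Exterior

/-! ### Čech cohomology: computing connecting maps and comparing classes on a cover. -/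

section Connecting

variable {E : Type*} [NormedAddCommGroup E] [NormedSpace ℂ E] {H : Type*} [TopologicalSpace H]
  {I : ModelWithCorners ℂ E H} {Y : Type u} [TopologicalSpace Y] [ChartedSpace H Y]
  {S' S S'' : FibSheaf.{u, v} I Y} {f : FibHom S' S} {g : FibHom S S''}

/-- Any lift of a cocycle computes the connecting homomorphism. -/
theorem FibExact.conn_cls_of_lift [T2Space Y] [ParacompactSpace Y] (hE : FibExact f g) {p : ℕ}
    (c : S''.cocycles p) (U : PtCover Y) (n : S.Fam (p + 1)) (hn : S.IsCochain U n)
    (hgn : ∀ σ z, U.Over σ z → g.app z (n σ z) = (c : S''.Fam (p + 1)) σ z)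
    (hc : ∀ σ z, U.Over σ z → cechD (c : S''.Fam (p + 1)) σ z = 0) :
    ∃ b : S'.cocycles (p + 1), hE.conn p (S''.cls p c) = S'.cls (p + 1) b ∧
      ∀ σ z, U.Over σ z → f.app z ((b : S'.Fam (p + 2)) σ z) = cechD n σ z := by
  -- Since `n` lifts the cocycle `c` on `U`, the image of `δn` under `g` is `δc = 0`, so `δn` comes
  -- from `S'`.
  obtain ⟨b, hb, hb'⟩ := hE.exists_ker U (cechD n) (FibSheaf.IsCochain.cechD S hn) fun σ z h => by
    rw [← g.cechD_fam]
    exact (cechD_eq_of_over (U := U) hgn h).trans (hc σ z h)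
  have hbc : b ∈ S'.cocycles (p + 1) := by
    refine ⟨U, hb, fun σ z h => hE.inj z ?_⟩
    rw [← f.cechD_fam, map_zero]
    refine (cechD_eq_of_over (U := U) hb' h).trans ?_
    rw [cechD_cechD]; rfl
  -- The connecting map was defined by choosing some lift. The present data also belong to its
  -- graph, and the graph is single-valued.
  exact ⟨⟨b, hbc⟩, hE.connRel_unique (hE.conn_spec _) ⟨c, ⟨b, hbc⟩, U, n, rfl, rfl, hn, hgn, hb'⟩,
    hb'⟩

/-- A family also carries irrelevant values off the intersections of the cover, so two
representatives of one class need not be equal as families. This allows an equality of classes to be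
checked over the points of the intersections alone. -/
theorem FibSheaf.cls_eq_of_over (S : FibSheaf.{u, v} I Y) {p : ℕ} (c e : S.cocycles p)
    (U : PtCover Y)
    (h : ∀ σ z, U.Over σ z → (c : S.Fam (p + 1)) σ z = (e : S.Fam (p + 1)) σ z) :
    S.cls p c = S.cls p e := by
  rw [S.cls_eq]
  cases p with
  | zero => exact ⟨U, fun σ z hz => sub_eq_zero.2 (h σ z hz)⟩
  | succ p =>
    -- In positive degree the difference vanishes on the cover, so it is there the coboundary of the
    -- zero cochain. In degree zero vanishing on a cover is itself the definition of a coboundary.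
    refine ⟨U, 0, fun _ z _ => (S.HolAt z).zero_mem, fun σ z hz => ?_⟩
    rw [cechD_eval]
    simpa [cechD] using sub_eq_zero.2 (h σ z hz)

end Connecting

/-! ### The same computation for sheaves: splittings, the extension class and the filtration. -/

section ExteriorSheaves

open exteriorPower

variable {E : Type*} [NormedAddCommGroup E] [NormedSpace ℂ E] {H : Type*} [TopologicalSpace H]
  {I : ModelWithCorners ℂ E H} {Y : Type u} [TopologicalSpace Y] [ChartedSpace H Y]
  {W V X : FibSheaf.{u, v} I Y} {i : FibHom W V} {p : FibHom V X}

/-- It suffices to test on generators, which are carried to products of sections `i u` and `s ξ` of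
`V`. This is what makes the explicit fibrewise lift of a cochain again a cochain. -/
theorem extLift_hol (i : FibHom W V) {b a j : ℕ} (h : b + a = j) {y : Y}
    {s : ∀ z, X.fib z →ₗ[ℂ] V.fib z} (hs : s ∈ (X.hom V).HolAt y)
    {t : ∀ z, (W.extTensor X b a).fib z} (ht : t ∈ (W.extTensor X b a).HolAt y) :
    (fun z => extLift h (i.app z) (s z) (t z)) ∈ (V.ext j).HolAt y := by
  refine FibSheaf.extTensor_hol W X (V.ext j) (fun z => extLift h (i.app z) (s z))
    (fun u ξ hu hξ => ?_) ht
  have := V.ext_mem (j := j) (y := y) (t := catTuple h (fun l z => i.app z (u l z))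
    fun l z => s z (ξ l z)) fun l => ?_
  · refine (V.ext j).congr (Eventually.of_forall fun z => ?_) this
    refine Eq.trans ?_ (extLift_tmul h (i.app z) (s z) _ _).symm
    congr 1
    subst h
    funext l
    refine Fin.addCases (fun l => ?_) (fun l => ?_) l <;> simp [catTuple]
  · subst h
    refine Fin.addCases (fun l => ?_) (fun l => ?_) l
    · simpa [catTuple] using i.hol y _ (hu l)
    · simpa [catTuple] using hs.self_of_nhds _ (hξ l)

/-- The extension class is represented by the differences of local splittings. -/
theorem FibSplit.exists_splittings [T2Space Y] [ParacompactSpace Y] (hS : FibSplit i p) :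
    ∃ (θ : (X.hom W).cocycles 1) (U : PtCover Y) (s : (Fin 1 → Y) → ∀ z, X.fib z →ₗ[ℂ] V.fib z),
      hS.extClass = (X.hom W).cls 1 θ ∧ (X.hom V).IsCochain U s ∧
      (∀ σ z, U.Over σ z → ∀ x, p.app z (s σ z x) = x) ∧
      ∀ σ z, U.Over σ z →
        i.app z ∘ₗ ((θ : (X.hom W).Fam 2) σ z : X.fib z →ₗ[ℂ] W.fib z) = cechD s σ z := by
  obtain ⟨c, θ, U, s, hc, hθ, hs, hps, his⟩ := (hS.homExact X).conn_spec
    ((X.hom X).cls0 (fun _ => LinearMap.id) fun _ => Eventually.of_forall fun _ _ hs => hs)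
  -- The cochain `s` lifts some representative `c` of the class of the identity, not the identity
  -- itself. In degree zero equal classes agree on a cover `N`, so `s` consists of genuine
  -- splittings after restriction to `U.inf N`.
  obtain ⟨N, hN⟩ := ((X.hom X).cls_eq _ _).1 hc
  refine ⟨θ, U.inf N, s, hθ.symm, fun σ z h => hs σ z h.left, fun σ z h x => ?_,
    fun σ z h => his σ z h.left⟩
  have h1 := LinearMap.congr_fun (hps σ z h.left) x
  exact h1.trans (LinearMap.congr_fun (sub_eq_zero.1 (hN σ z h.right)) x)

/-- On `⋀ᵇ W ⊗ X` the connecting map of the filtration is the product with the extension class. -/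
theorem FibSplit.symbol_conn_eq_cup [T2Space Y] [ParacompactSpace Y] (hS : FibSplit i p)
    (R : FibSheaf.{u, v} I Y) {b j : ℕ} (h : b + 1 = j) (h' : b + 1 + 0 = j) (q : ℕ)
    (ν : (R.hom (W.extTensor X b 1)).Coh q) :
    ((hS.symbol h').post R).cohMap (q + 1) (((hS.filtSplit h).homExact R).conn q ν) =
      ((contrPairing W X b 0).post R).cup q hS.extClass ν := by
  obtain ⟨c, rfl⟩ := (R.hom (W.extTensor X b 1)).cls_surjective q ν
  obtain ⟨θ, U, s, hθ, hs, hps, his⟩ := hS.exists_splittings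
  obtain ⟨N, hN, hN'⟩ := c.2
  -- Lift `c_σ` with the splitting attached to the first index `σ 0`. The cup product also puts `θ`
  -- in front, on the indices `σ 0, σ 1`, so the Leibniz rule produces it without a sign.
  let n : (R.hom (filtSheaf i j b)).Fam (q + 1) := fun σ z =>
    ((extLift h (i.app z) (s ![σ 0] z)).codRestrict (extFilt (i.app z) j b)
      (extLift_mem h (i.app z) (s ![σ 0] z))) ∘ₗ
        ((c : (R.hom (W.extTensor X b 1)).Fam (q + 1)) σ z)
  have hU : ∀ {σ : Fin (q + 1) → Y} {z : Y}, (U.inf N).Over σ z → U.Over ![σ 0] z :=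
    fun hz k => by fin_cases k; exact hz.left 0
  obtain ⟨β, hβ, hβ'⟩ := ((hS.filtSplit h).homExact R).conn_cls_of_lift c (U.inf N) n
    (fun σ z hz => by
      -- A section of a `ℋom` sheaf is defined by a condition at all nearby points, so the splitting
      -- must be available as a section at each of them.
      filter_upwards [(X.hom V).spread (hs _ z (hU hz)), hN σ z hz.right] with x hx hx' r hr
      exact extLift_hol i h hx (hx' r hr))
    (fun σ z hz => LinearMap.ext fun r => extSymbol_extLift h (i.app z) (p.app z) (hS.inj z)
      (fun w => (hS.exact z _).2 ⟨w, rfl⟩) _ (hps _ z (hU hz)) _)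
    (fun σ z hz => hN' σ z hz.right)
  rw [hβ, hθ, FibHom.cohMap_cls, FibPairing.cup_cls]
  refine FibSheaf.cls_eq_of_over _ _ _ (U.inf N) fun σ z hz => LinearMap.ext fun r => ?_
  refine extSymbol_eq_extContr h h' (i.app z) (p.app z) (hS.inj z)
    (fun w => (hS.exact z _).2 ⟨w, rfl⟩) _ _ _ ?_
  -- Evaluate at `r` and forget the filtration. The linearity of the lift in the splitting is a
  -- statement in `⋀ʲ V`, so the coboundary of `n` is computed there.
  let ev : ((R.hom (filtSheaf i j b)).fib z) →ₗ[ℂ] ⋀[ℂ]^j (V.fib z) :=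
    (extFilt (i.app z) j b).subtype ∘ₗ LinearMap.applyₗ r
  have h1 := congrArg ev (hβ' σ z hz)
  refine h1.trans ?_
  let evR : ((R.hom (W.extTensor X b 1)).fib z) →ₗ[ℂ] (W.extTensor X b 1).fib z :=
    LinearMap.applyₗ r
  -- With the fibre point `z` and the argument `r` fixed, `n` is the product of the `0`-cochain `s`
  -- and the evaluated cocycle `c` under the pairing `extLiftOne`. Bilinearity of this pairing is
  -- what the Leibniz rule requires.
  have h2 := cechD_cup0 (LinearMap.toAddMonoidHom'.comp (extLiftOne h (i.app z)).toAddMonoidHom)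
    (fun τ => s τ z)
    (fun τ => evR ((c : (R.hom (W.extTensor X b 1)).Fam (q + 1)) τ z)) σ
  -- The second Leibniz term contains `δc`, which vanishes at `z` because `c` is a cocycle on `N`;
  -- evaluation at `r` commutes with `δ`.
  have h3 : cechD (fun τ => evR ((c : (R.hom (W.extTensor X b 1)).Fam (q + 1)) τ z)) σ = 0 := by
    have := cechD_map (A' := ⋀[ℂ]^b (W.fib z) ⊗[ℂ] ⋀[ℂ]^1 (X.fib z)) evR.toAddMonoidHom
      (fun τ => (c : (R.hom (W.extTensor X b 1)).Fam (q + 1)) τ z) σ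
    refine this.symm.trans ?_
    rw [← cechD_eval, hN' σ z hz.right, map_zero]
  rw [h3, map_zero, add_zero] at h2
  rw [cechD_eval]
  refine (cechD_map ev.toAddMonoidHom (fun τ => n τ z) σ).trans (h2.trans ?_)
  -- The remaining factor `δs` on `(σ 0, σ 1)` is `i ∘ θ`, the form required for reading off the
  -- symbol.
  have h4 := (his ![σ 0, σ 1] z hz.left.pair).trans (cechD_eval (X.hom V) s _ z)
  exact congrArg (fun φ => extLift h (i.app z) φ (evR ((c : (R.hom (W.extTensor X b 1)).Fam (q + 1))
    (Fin.tail σ) z))) h4.symm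

end ExteriorSheaves

/-! ### The inclusion of images for a `gt`-model. -/

theorem mainTheorem11 {EX EB : Type u} [NormedAddCommGroup EX] [NormedSpace ℂ EX]
    [FiniteDimensional ℂ EX] [NormedAddCommGroup EB] [NormedSpace ℂ EB] [FiniteDimensional ℂ EB]
    {X B : Type u} [TopologicalSpace X] [ChartedSpace EX X] [IsManifold 𝓘(ℂ, EX) ω X]
    [T2Space X] [SecondCountableTopology X]
    [TopologicalSpace B] [ChartedSpace EB B] [IsManifold 𝓘(ℂ, EB) ω B]
    [T2Space B] [SecondCountableTopology B]
    (M : GTModel EX EB X B) (j b : ℕ) (h : 1 + b = j) (p : ℕ) :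
    LinearMap.range (M.modelClassMap j 0 b p) ≤
      LinearMap.range (M.obstructionMap (a := 0) (b := b) h p) := by
  have := paracompact_prod EX EB X B
  rintro _ ⟨ν, rfl⟩
  -- The preimage is `ν` itself, because the two maps agree on it. One proof of `b + 1 = j` serves
  -- for both index equations, as `b + 1 + 0` reduces to `b + 1`.
  exact ⟨ν, M.fibSplit.symbol_conn_eq_cup (M.Tpm j) ((add_comm b 1).trans h)
    ((add_comm b 1).trans h) p ν⟩
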